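/- Let $R$ be a commutative ring. For a directed graph $G$ with shortest path metric $d$ (so $d(x,y)$ is the least number of edges in a directed path from $x$ to $y$), let $\mathrm{RC}_k(G)$ be the free $R$-module on the tuples $(x_0,\dots,x_k)$ of vertices in which consecutive entries are distinct and there is a directed path from each entry to the next, with differential $\partial(x_0,\dots,x_k)=\sum_{i=0}^k(-1)^i(x_0,\dots,\widehat{x_i},\dots,x_k)$, where terms with repeated consecutive entries are omitted (and $\partial=0$ on $\mathrm{RC}_0(G)$). The length of a tuple is $\ell(x_0,\dots,x_k)=\sum_{i=1}^{k}d(x_{i-1},x_i)$, and $F_p\mathrm{RC}_k(G)$ is spanned by the generators of length at most $p$. The magnitude-path spectral sequence (MPSS) $\{E^r_{i,j}(G),d^r\}_{r\ge 0}$ is the spectral sequence of this filtered chain complex, with $E^0_{i,j}(G)=F_i\mathrm{RC}_{i+j}(G)/F_{i-1}\mathrm{RC}_{i+j}(G)$ and with all pages regarded as subquotients of $E^0$. The magnitude chains $\mathrm{MC}_{k,\ell}(G)$ are spanned by the generators of degree $k$ and length exactly $\ell$, with differential $\partial$ in which all terms of length less than $\ell$ are omitted; the magnitude homology is $\mathrm{MH}_{k,\ell}(G)=H_k(\mathrm{MC}_{*,\ell}(G))$,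 and the bigraded path homology is $\mathrm{PH}_{k,\ell}(G)=E^2_{\ell,k-\ell}(G)$. **Theorem.** Let $m\ge 3$ and let $Z_m$ be the directed cycle with $m$ vertices, i.e. the directed graph with vertex set $\mathbb{Z}/m$ and edges $x\to x+1$. Then: 1. For every integer $i\ge 0$, $\mathrm{MH}_{2i,mi}(Z_m)$ and $\mathrm{MH}_{2i+1,mi+1}(Z_m)$ are free $R$-modules of rank $m$, and $\mathrm{MH}_{k,\ell}(Z_m)=0$ for all other bidegrees $(k,\ell)\in\mathbb{Z}^2$. 2. For every integer $i\ge 0$, $\mathrm{PH}_{2i,mi}(Z_m)$ and $\mathrm{PH}_{2i+1,mi+1}(Z_m)$ are free $R$-modules of rank $1$, and $\mathrm{PH}_{k,\ell}(Z_m)=0$ for all other bidegrees $(k,\ell)\in\mathbb{Z}^2$. 3. The MPSS of $Z_m$ satisfies $E^2(Z_m)=E^3(Z_m)=\cdots=E^{m-1}(Z_m)$; that is, for $2\le r\le m-2$ the differential $d^r$ vanishes in all bidegrees and $E^{r+1}(Z_m)=E^r(Z_m)$ as subquotients of $E^0(Z_m)$. 4. $E^m_{0,0}(Z_m)\cong R$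 as $R$-modules, and $E^m_{i,j}(Z_m)=0$ for all $(i,j)\ne(0,0)$. -/

import Mathlib

noncomputable section

namespace MagnitudePath

universe u v

/-! ### The spectral sequence of a filtered chain complex -/

/-- The subquotient `Z / B` of a module `M`, for submodules `B ≤ Z` of `M`. -/
abbrev Subquotient {R : Type v} [CommRing R] {M : Type u} [AddCommGroup M] [Module R M]
    (Z B : Submodule R M) : Type u :=
  Z ⧸ B.submoduleOf Z

/-- A filtered chain complex of `R`-modules, written inside the direct sum `M` of its chain
modules: `filt p k` is the part `F_p C_k` of filtration `p` and degree `k`. -/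
structure FilteredComplex (R : Type v) [CommRing R] (M : Type u) [AddCommGroup M] [Module R M] where
  d : M →ₗ[R] M
  filt : ℤ → ℤ → Submodule R M
  d_d : ∀ c, d (d c) = 0
  filt_mono : ∀ p k, filt (p - 1) k ≤ filt p k
  d_mem : ∀ p k, ∀ c ∈ filt p k, d c ∈ filt p (k - 1)

namespace FilteredComplex

variable {R : Type v} [CommRing R] {M : Type u} [AddCommGroup M] [Module R M]
  (C : FilteredComplex R M)

/-- `A^r_p = {c ∈ F_p C_k : d c ∈ F_{p-r} C_{k-1}}`. -/
def approxCycles (r p k : ℤ) : Submodule R M :=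
  C.filt p k ⊓ (C.filt (p - r) (k - 1)).comap C.d

/-- The numerator of the `E^r`-page in filtration degree `p` and total degree `k`, as a submodule
of `F_p C_k` containing `F_{p-1} C_k`. -/
def pageZ (r : ℕ) (p k : ℤ) : Submodule R M :=
  C.approxCycles r p k ⊔ C.filt (p - 1) k

/-- The denominator of the `E^r`-page in filtration degree `p` and total degree `k`, as a submodule
of `F_p C_k` containing `F_{p-1} C_k`. -/
def pageB (r : ℕ) (p k : ℤ) : Submodule R M :=
  (C.approxCycles ((r : ℤ) - 1) (p + r - 1) (k + 1)).map C.d ⊔ C.filt (p - 1) k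

theorem pageB_le_pageZ (r : ℕ) (p k : ℤ) : C.pageB r p k ≤ C.pageZ r p k := by
  refine sup_le_sup_right ?_ _
  rintro _ ⟨c, ⟨-, hc⟩, rfl⟩
  refine ⟨?_, ?_⟩
  · have h := Submodule.mem_comap.1 hc
    rwa [show p + (r : ℤ) - 1 - (r - 1) = p by ring, add_sub_cancel_right] at h
  · simp [C.d_d]

/-- The `E^r`-page in filtration degree `p` and total degree `k`, i.e. `E^r_{p, k - p}`. All pages
are realized as subquotients of `E^0_p = F_p / F_{p-1}`. -/
abbrev Page (r : ℕ) (p k : ℤ) : Type u := Subquotient (C.pageZ r p k) (C.pageB r p k)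

/-- The class in the `E^r`-page of an element of `A^r_p`. -/
def pageClass (r : ℕ) (p k : ℤ) : C.approxCycles r p k →ₗ[R] C.Page r p k :=
  Submodule.mkQ _ ∘ₗ Submodule.inclusion (le_sup_left : _ ≤ C.pageZ r p k)

theorem pageClass_surjective (r : ℕ) (p k : ℤ) : Function.Surjective (C.pageClass r p k) := by
  intro e
  obtain ⟨⟨z, hz⟩, rfl⟩ := Submodule.mkQ_surjective _ e
  obtain ⟨a, ha, f, hf, rfl⟩ := Submodule.mem_sup.1 hz
  refine ⟨⟨a, ha⟩, ?_⟩
  simp only [pageClass, LinearMap.comp_apply, Submodule.mkQ_apply]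
  rw [Submodule.Quotient.eq]
  change a - (a + f) ∈ C.pageB r p k
  rw [sub_add_cancel_left]
  exact neg_mem (Submodule.mem_sup_right hf)

theorem pageClass_eq_zero_iff (r : ℕ) (p k : ℤ) (c : C.approxCycles r p k) :
    C.pageClass r p k c = 0 ↔ (c : M) ∈ C.pageB r p k := by
  simp only [pageClass, LinearMap.comp_apply, Submodule.mkQ_apply]
  rw [Submodule.Quotient.mk_eq_zero]
  rfl

/-- The differential of `C` as a map `A^r_p → A^r_{p-r}`. -/
def dApprox (r : ℕ) (p k : ℤ) : C.approxCycles r p k →ₗ[R] C.approxCycles r (p - r) (k - 1) :=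
  C.d.restrict (fun _ hc => ⟨hc.2, by simp [C.d_d]⟩)

theorem ker_pageClass_le (r : ℕ) (p k : ℤ) :
    LinearMap.ker (C.pageClass r p k) ≤
      LinearMap.ker (C.pageClass r (p - r) (k - 1) ∘ₗ C.dApprox r p k) := by
  rintro ⟨a, ha⟩ h
  rw [LinearMap.mem_ker, pageClass_eq_zero_iff] at h
  rw [LinearMap.mem_ker, LinearMap.comp_apply, pageClass_eq_zero_iff]
  obtain ⟨_, ⟨b, hb, rfl⟩, f, hf, hbf⟩ := Submodule.mem_sup.1 h
  have hbf' : C.d b + f = a := hbf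
  have hbd : C.d a = C.d f := by rw [← hbf', map_add, C.d_d, zero_add]
  refine Submodule.mem_sup_left ⟨f, ?_, hbd.symm⟩
  rw [show p - (r : ℤ) + r - 1 = p - 1 by ring, show k - 1 + 1 = k by ring]
  refine ⟨hf, ?_⟩
  simp only [SetLike.mem_coe, Submodule.mem_comap]
  rw [← hbd, show p - 1 - ((r : ℤ) - 1) = p - r by ring]
  exact ha.2

/-- The differential `d^r` of the spectral sequence, sending the class of `c ∈ A^r_p` to the class
of `d c ∈ A^r_{p-r}`. -/
def pageDiff (r : ℕ) (p k : ℤ) : C.Page r p k →ₗ[R] C.Page r (p - r) (k - 1) :=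
  (LinearMap.ker (C.pageClass r p k)).liftQ
      (C.pageClass r (p - r) (k - 1) ∘ₗ C.dApprox r p k) (C.ker_pageClass_le r p k) ∘ₗ
    ((C.pageClass r p k).quotKerEquivOfSurjective (C.pageClass_surjective r p k)).symm.toLinearMap

theorem pageDiff_pageClass (r : ℕ) (p k : ℤ) (c : C.approxCycles r p k) :
    C.pageDiff r p k (C.pageClass r p k c) =
      C.pageClass r (p - r) (k - 1) (C.dApprox r p k c) := by
  have h : ((C.pageClass r p k).quotKerEquivOfSurjective
      (C.pageClass_surjective r p k)).symm (C.pageClass r p k c) = Submodule.Quotient.mk c := by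
    rw [LinearEquiv.symm_apply_eq]
    rfl
  simp only [pageDiff, LinearMap.comp_apply, LinearEquiv.coe_coe, h]
  rfl

/-- `E^r = E^s`: in every bidegree the two pages are the same subquotient of `E^0`. -/
def PagesEqual (r s : ℕ) : Prop :=
  ∀ p k : ℤ, C.pageZ r p k = C.pageZ s p k ∧ C.pageB r p k = C.pageB s p k

end FilteredComplex

variable {V : Type u}

/-! ### Directed graphs and the shortest path metric -/

/-- `IsPath G n x y`: there is a directed path `x = x₀ → x₁ → ⋯ → xₙ = y` with `n` edges. -/
inductive IsPath (G : Digraph V) : ℕ → V → V → Prop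
  | nil (x : V) : IsPath G 0 x x
  | cons {n : ℕ} {x y z : V} : G.Adj x y → IsPath G n y z → IsPath G (n + 1) x z

/-- There is a directed path from `x` to `y`. -/
def Reach (G : Digraph V) (x y : V) : Prop := ∃ n, IsPath G n x y

/-- The shortest path metric, as a natural number. It is only ever evaluated at pairs `x, y` with
a directed path from `x` to `y`, so that the infimum is over a nonempty set and the distance is
finite. -/
def dist (G : Digraph V) (x y : V) : ℕ := sInf {n | IsPath G n x y}

/-- The length `d(x₀,x₁) + ⋯ + d(xₖ₋₁,xₖ)` of a tuple of vertices. -/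
def tupleLength (G : Digraph V) : List V → ℕ
  | [] => 0
  | [_] => 0
  | x :: y :: l => dist G x y + tupleLength G (y :: l)

/-- The directed cycle with `m` vertices. -/
def directedCycle (m : ℕ) : Digraph (ZMod m) where
  Adj x y := y = x + 1

/-! ### Reachability chains -/

/-- A tuple `(x₀,…,xₖ)`, `k ≥ 0`, in which consecutive entries are distinct and there is a directed
path from each entry to the next. -/
def IsGenerator (G : Digraph V) (l : List V) : Prop :=
  l ≠ [] ∧ l.IsChain (fun x y => x ≠ y) ∧ l.IsChain (Reach G)

/-- The generators of the reachability chain complex, of all degrees. -/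
abbrev Generator (G : Digraph V) : Type u := {l : List V // IsGenerator G l}

/-- The degree of `(x₀,…,xₖ)` is `k`. -/
def Generator.degree {G : Digraph V} (x : Generator G) : ℤ := (x.1.length : ℤ) - 1

/-- The length of a generator. -/
def Generator.length {G : Digraph V} (x : Generator G) : ℕ := tupleLength G x.1

variable (R : Type v) [CommRing R]

/-- The reachability chains of `G`: the direct sum over all degrees `k` of the free modules on the
generators of degree `k`. -/
abbrev RC (G : Digraph V) : Type (max u v) := Generator G →₀ R

/-- The sum `∑ (-1)ⁱ (x₀,…,x̂ᵢ,…,xₖ)`, as a combination of arbitrary tuples. -/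
def faces (l : List V) : List V →₀ R :=
  ∑ i ∈ Finset.range l.length, Finsupp.single (l.eraseIdx i) ((-1) ^ i)

/-- Omit all tuples that are not generators. -/
def toRC (G : Digraph V) : (List V →₀ R) →ₗ[R] RC R G :=
  Finsupp.lcomapDomain Subtype.val Subtype.val_injective

/-- The differential `∂(x₀,…,xₖ) = ∑ (-1)ⁱ (x₀,…,x̂ᵢ,…,xₖ)` of reachability chains, where terms with
repeated consecutive entries are omitted (and the empty tuple, so that `∂` vanishes in degree 0). -/
def boundary (G : Digraph V) : RC R G →ₗ[R] RC R G :=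
  Finsupp.linearCombination R (fun x : Generator G => toRC R G (faces R x.1))

theorem faces_cons (a : V) (l : List V) :
    faces R (a :: l) =
      Finsupp.single l 1 - Finsupp.lmapDomain R R (List.cons a) (faces R l) := by
  simp only [faces, List.length_cons, Finset.sum_range_succ', map_sum, Finsupp.lmapDomain_apply,
    Finsupp.mapDomain_single, List.eraseIdx_cons_succ, List.eraseIdx_cons_zero, pow_zero, pow_succ,
    mul_neg, mul_one, Finsupp.single_neg, Finset.sum_neg_distrib]
  abel

theorem faces_degenerate (l : List V) (hl : ¬ l.IsChain (fun x y => x ≠ y)) :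
    faces R l ∈ Finsupp.supported R R {l : List V | ¬ l.IsChain (fun x y => x ≠ y)} := by
  induction l with
  | nil => exact absurd List.IsChain.nil hl
  | cons a l ih =>
    have hcons : ∀ (s : Set (List V)) (z : List V →₀ R), z ∈ Finsupp.supported R R s →
        (∀ w ∈ s, ¬ (a :: w).IsChain (fun x y => x ≠ y)) →
        Finsupp.lmapDomain R R (List.cons a) z ∈
          Finsupp.supported R R {l : List V | ¬ l.IsChain (fun x y => x ≠ y)} := by
      intro s z hz hs
      have h1 : Finsupp.lmapDomain R R (List.cons a) z ∈
          Finsupp.supported R R ((List.cons a) '' s) := by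
        rw [← Finsupp.lmapDomain_supported]
        exact ⟨z, hz, rfl⟩
      refine Finsupp.supported_mono ?_ h1
      rintro _ ⟨w, hw, rfl⟩
      exact hs w hw
    cases l with
    | nil => exact absurd (List.IsChain.singleton a) hl
    | cons b l =>
      by_cases hb : (b :: l).IsChain (fun x y => x ≠ y)
      · have hab : a = b := by
          by_contra h
          exact hl (List.isChain_cons_cons.2 ⟨h, hb⟩)
        subst hab
        have h0 : Finsupp.lmapDomain R R (List.cons a) (Finsupp.single l (1 : R)) =
            Finsupp.single (a :: l) 1 := by simp
        rw [faces_cons, faces_cons, map_sub, h0, sub_sub_cancel]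
        refine hcons (Set.range (List.cons a)) _ ?_ ?_
        · have h1 : Finsupp.lmapDomain R R (List.cons a) (faces R l) ∈
              Finsupp.supported R R ((List.cons a) '' Set.univ) := by
            rw [← Finsupp.lmapDomain_supported]
            exact ⟨faces R l, by simp, rfl⟩
          simpa using h1
        · rintro _ ⟨w, rfl⟩ h
          exact (List.isChain_cons_cons.1 h).1 rfl
      · rw [faces_cons]
        refine Submodule.sub_mem _ (Finsupp.single_mem_supported R 1 hb) ?_
        refine hcons _ _ (ih hb) ?_
        intro w hw h
        exact hw h.tail

theorem faces_faces (l : List V) :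
    Finsupp.linearCombination R (faces R) (faces R l) = 0 := by
  induction l with
  | nil => simp [faces]
  | cons a l ih =>
    have key : ∀ z : List V →₀ R,
        Finsupp.linearCombination R (faces R) (Finsupp.lmapDomain R R (List.cons a) z) =
          z - Finsupp.lmapDomain R R (List.cons a)
            (Finsupp.linearCombination R (faces R) z) := by
      intro z
      induction z using Finsupp.induction_linear with
      | zero => simp
      | add f g hf hg => rw [map_add, map_add, hf, hg, map_add, map_add]; abel
      | single w c =>
        rw [Finsupp.lmapDomain_apply, Finsupp.mapDomain_single,
          Finsupp.linearCombination_single, Finsupp.linearCombination_single, faces_cons,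
          smul_sub, map_smul]
        simp
    rw [faces_cons, map_sub, key, ih, Finsupp.linearCombination_single]
    simp

theorem isPath_trans {G : Digraph V} {a b : ℕ} {x y z : V} (h₁ : IsPath G a x y)
    (h₂ : IsPath G b y z) : IsPath G (a + b) x z := by
  induction h₁ with
  | nil x => simpa using h₂
  | cons h _ ih =>
    rw [Nat.add_right_comm]
    exact IsPath.cons h (ih h₂)

instance reachTrans (G : Digraph V) : Trans (Reach G) (Reach G) (Reach G) where
  trans := fun ⟨_, h₁⟩ ⟨_, h₂⟩ => ⟨_, isPath_trans h₁ h₂⟩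

theorem toRC_single_of_not {G : Digraph V} {l : List V} (hl : ¬ IsGenerator G l) (c : R) :
    toRC R G (Finsupp.single l c) = 0 := by
  ext x
  have : l ≠ x.1 := fun h => hl (h ▸ x.2)
  simp [toRC, Finsupp.lcomapDomain, this]

theorem toRC_single {G : Digraph V} (x : Generator G) (c : R) :
    toRC R G (Finsupp.single x.1 c) = Finsupp.single x c := by
  classical
  ext y
  simp [toRC, Finsupp.lcomapDomain, Finsupp.single_apply, Subtype.ext_iff]

theorem boundary_toRC_single (G : Digraph V) (l : List V) (hl : l.IsChain (Reach G)) (c : R) :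
    boundary R G (toRC R G (Finsupp.single l c)) = toRC R G (c • faces R l) := by
  by_cases hg : IsGenerator G l
  · rw [toRC_single R (⟨l, hg⟩ : Generator G), boundary, Finsupp.linearCombination_single,
      map_smul]
  · rw [toRC_single_of_not R hg, map_zero, map_smul]
    suffices h : toRC R G (faces R l) = 0 by rw [h, smul_zero]
    by_cases hn : l = []
    · subst hn; simp [faces]
    · have hd : ¬ l.IsChain (fun x y => x ≠ y) := fun h => hg ⟨hn, h, hl⟩
      have hf := (Finsupp.mem_supported' R _).1 (faces_degenerate R l hd)
      ext x
      simpa [toRC, Finsupp.lcomapDomain] using hf x.1 (by simpa using x.2.2.1)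

/-- The reachability chains form a chain complex. -/
theorem boundary_boundary (G : Digraph V) (c : RC R G) : boundary R G (boundary R G c) = 0 := by
  induction c using Finsupp.induction_linear with
  | zero => simp
  | add f g hf hg => rw [map_add, map_add, hf, hg, add_zero]
  | single x c =>
    suffices h : boundary R G (toRC R G (faces R x.1)) = 0 by
      rw [boundary, Finsupp.linearCombination_single, ← boundary, map_smul, h, smul_zero]
    have h1 : boundary R G (toRC R G (faces R x.1)) =
        toRC R G (Finsupp.linearCombination R (faces R) (faces R x.1)) := by
      conv_lhs => rw [faces]
      conv_rhs => arg 2; arg 2; rw [faces]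
      simp only [map_sum, Finsupp.linearCombination_single]
      refine Finset.sum_congr rfl fun i _ => ?_
      rw [boundary_toRC_single R G _ (x.2.2.2.sublist (List.eraseIdx_sublist _ _))]
    rw [h1, faces_faces, map_zero]

/-! ### The length filtration and the magnitude-path spectral sequence -/

theorem isPath_dist {G : Digraph V} {x y : V} (h : Reach G x y) : IsPath G (dist G x y) x y :=
  Nat.sInf_mem h

theorem dist_triangle {G : Digraph V} {x y z : V} (h₁ : Reach G x y) (h₂ : Reach G y z) :
    dist G x z ≤ dist G x y + dist G y z :=
  Nat.sInf_le (isPath_trans (isPath_dist h₁) (isPath_dist h₂))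

/-- Omitting an entry does not increase the length. -/
theorem tupleLength_eraseIdx_le (G : Digraph V) (l : List V) (hl : l.IsChain (Reach G)) (i : ℕ) :
    tupleLength G (l.eraseIdx i) ≤ tupleLength G l := by
  induction l generalizing i with
  | nil => simp
  | cons a l ih =>
    cases l with
    | nil => cases i <;> simp [tupleLength]
    | cons b l =>
      obtain ⟨hab, hl⟩ := List.isChain_cons_cons.1 hl
      match i with
      | 0 => simp [tupleLength]
      | 1 =>
        cases l with
        | nil => simp [tupleLength]
        | cons c l =>
          have := dist_triangle hab (List.isChain_cons_cons.1 hl).1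
          simp only [List.eraseIdx_cons_succ, List.eraseIdx_cons_zero, tupleLength]
          omega
      | i + 2 =>
        have := ih hl (i + 1)
        simp only [List.eraseIdx_cons_succ, tupleLength] at this ⊢
        omega

theorem boundary_single_mem (G : Digraph V) (x : Generator G) (c : R) :
    boundary R G (Finsupp.single x c) ∈ Finsupp.supported R R
      {y : Generator G | y.degree = x.degree - 1 ∧ y.length ≤ x.length} := by
  rw [boundary, Finsupp.linearCombination_single, faces, map_sum]
  refine Submodule.smul_mem _ _ (Submodule.sum_mem _ fun i hi => ?_)
  by_cases hg : IsGenerator G (x.1.eraseIdx i)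
  · rw [toRC_single R (⟨_, hg⟩ : Generator G)]
    refine Finsupp.single_mem_supported R _ ⟨?_, tupleLength_eraseIdx_le G _ x.2.2.2 i⟩
    have hi' := Finset.mem_range.1 hi
    simp only [Generator.degree, List.length_eraseIdx, hi', if_true]
    omega
  · rw [toRC_single_of_not R hg]
    exact zero_mem _

theorem boundary_mem {G : Digraph V} {s t : Set (Generator G)}
    (h : ∀ x ∈ s, ∀ y : Generator G, y.degree = x.degree - 1 → y.length ≤ x.length → y ∈ t)
    {c : RC R G} (hc : c ∈ Finsupp.supported R R s) :
    boundary R G c ∈ Finsupp.supported R R t := by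
  rw [← Finsupp.sum_single c, Finsupp.sum, map_sum]
  refine Submodule.sum_mem _ fun x hx => ?_
  exact Finsupp.supported_mono (fun y hy => h x (hc hx) y hy.1 hy.2)
    (boundary_single_mem R G x (c x))

/-- The reachability chain complex of `G` with the length filtration: `F_p RC_k(G)` is spanned by
the generators of degree `k` and length at most `p`. -/
def reachability (G : Digraph V) : FilteredComplex R (RC R G) where
  d := boundary R G
  filt p k := Finsupp.supported R R {x : Generator G | x.degree = k ∧ (x.length : ℤ) ≤ p}
  d_d := boundary_boundary R G
  filt_mono p k := Finsupp.supported_mono fun x hx => ⟨hx.1, by have := hx.2; omega⟩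
  d_mem p k _ hc := boundary_mem R
    (t := {x : Generator G | x.degree = k - 1 ∧ (x.length : ℤ) ≤ p}) (fun x hx y h₁ h₂ => ⟨by rw [h₁, hx.1], by
    have := hx.2; omega⟩) hc

/-- The term `E^r_{i,j}(G)` of the magnitude-path spectral sequence, the spectral sequence of the
reachability chain complex with its length filtration. -/
abbrev E (G : Digraph V) (r : ℕ) (i j : ℤ) : Type (max u v) := (reachability R G).Page r i (i + j)

/-- Bigraded path homology `PH_{k,ℓ}(G) = E^2_{ℓ,k-ℓ}(G)`. -/
abbrev PH (G : Digraph V) (k ℓ : ℤ) : Type (max u v) := E R G 2 ℓ (k - ℓ)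

/-! ### Magnitude homology -/

/-- The magnitude chains `MC_{k,ℓ}(G)`, with basis the generators of degree `k` and length exactly
`ℓ`. -/
def MC (G : Digraph V) (k ℓ : ℤ) : Submodule R (RC R G) :=
  Finsupp.supported R R {x : Generator G | x.degree = k ∧ (x.length : ℤ) = ℓ}

/-- The differential of the magnitude chains: that of the reachability chains, with all terms of
smaller length omitted. -/
def magBoundary (G : Digraph V) : RC R G →ₗ[R] RC R G :=
  Finsupp.linearCombination R (fun x : Generator G =>
    (boundary R G (Finsupp.single x 1)).filter (fun y => y.length = x.length))

/-- The cycles of `MC_{*,ℓ}(G)` in degree `k`. -/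
def magCycles (G : Digraph V) (k ℓ : ℤ) : Submodule R (RC R G) :=
  MC R G k ℓ ⊓ LinearMap.ker (magBoundary R G)

/-- The boundaries of `MC_{*,ℓ}(G)` in degree `k`. -/
def magBoundaries (G : Digraph V) (k ℓ : ℤ) : Submodule R (RC R G) :=
  (MC R G (k + 1) ℓ).map (magBoundary R G)

/-- Magnitude homology `MH_{k,ℓ}(G) = H_k(MC_{*,ℓ}(G))`. -/
abbrev MH (G : Digraph V) (k ℓ : ℤ) : Type (max u v) :=
  Subquotient (magCycles R G k ℓ) (magBoundaries R G k ℓ)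

theorem magBoundary_eq_filter (G : Digraph V) (n : ℕ) (c : RC R G)
    (hc : c ∈ Finsupp.supported R R {x : Generator G | x.length = n}) :
    magBoundary R G c = (boundary R G c).filter (fun y => y.length = n) := by
  have key : ∀ z : RC R G, z.filter (fun y => y.length = n) =
      Finsupp.restrictDom R R {y : Generator G | y.length = n} z := fun z => rfl
  rw [key]
  conv_lhs => rw [← Finsupp.sum_single c, Finsupp.sum, map_sum]
  conv_rhs => rw [← Finsupp.sum_single c, Finsupp.sum, map_sum, map_sum,
    AddSubmonoidClass.coe_finsetSum]
  refine Finset.sum_congr rfl fun x hx => ?_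
  have hx' : x.length = n := hc hx
  rw [magBoundary, Finsupp.linearCombination_single, hx', key, ← Submodule.coe_smul, ← map_smul,
    ← map_smul, Finsupp.smul_single_one]

theorem magBoundaries_le_magCycles (G : Digraph V) (k ℓ : ℤ) :
    magBoundaries R G k ℓ ≤ magCycles R G k ℓ := by
  rintro _ ⟨c, hc, rfl⟩
  by_cases hℓ : ∃ n : ℕ, (n : ℤ) = ℓ
  · obtain ⟨n, rfl⟩ := hℓ
    have hcn : c ∈ Finsupp.supported R R {x : Generator G | x.length = n} :=
      Finsupp.supported_mono (fun x hx => Int.ofNat_inj.1 hx.2) hc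
    have hb : boundary R G c ∈ Finsupp.supported R R
        {x : Generator G | x.degree = k ∧ x.length ≤ n} :=
      boundary_mem R (t := {x : Generator G | x.degree = k ∧ x.length ≤ n})
        (fun x hx y h₁ h₂ => ⟨by rw [h₁, hx.1]; ring, by
        have := hx.2; omega⟩) hc
    have hm := magBoundary_eq_filter R G n c hcn
    have hmem : magBoundary R G c ∈ MC R G k n := by
      rw [hm, MC, Finsupp.mem_supported']
      intro x hx
      by_cases hxn : x.length = n
      · rw [Finsupp.filter_apply_pos (fun y : Generator G => y.length = n) _ hxn]
        refine (Finsupp.mem_supported' R _).1 hb x fun h => hx ⟨h.1, ?_⟩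
        exact_mod_cast hxn
      · rw [Finsupp.filter_apply_neg (fun y : Generator G => y.length = n) _ hxn]
    refine ⟨hmem, LinearMap.mem_ker.2 ?_⟩
    rw [magBoundary_eq_filter R G n _
      (Finsupp.supported_mono (fun x hx => Int.ofNat_inj.1 hx.2) hmem)]
    have hlow : boundary R G c - magBoundary R G c ∈ Finsupp.supported R R
        {x : Generator G | x.length < n} := by
      rw [hm, Finsupp.mem_supported']
      intro x hx
      rw [Finsupp.sub_apply]
      by_cases hxn : x.length = n
      · rw [Finsupp.filter_apply_pos (fun y : Generator G => y.length = n) _ hxn, sub_self]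
      · rw [Finsupp.filter_apply_neg (fun y : Generator G => y.length = n) _ hxn, sub_zero]
        refine (Finsupp.mem_supported' R _).1 hb x fun h => hx (lt_of_le_of_ne h.2 hxn)
    have hlow' := boundary_mem R (t := {x : Generator G | x.length < n})
      (fun x hx y _ h => lt_of_le_of_lt h hx) hlow
    rw [map_sub, boundary_boundary, zero_sub] at hlow'
    ext x
    by_cases hxn : x.length = n
    · rw [Finsupp.filter_apply_pos (fun y : Generator G => y.length = n) _ hxn]
      have := (Finsupp.mem_supported' R _).1 hlow' x (by simp [hxn])
      simpa using this
    · rw [Finsupp.filter_apply_neg (fun y : Generator G => y.length = n) _ hxn]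
      rfl
  · have h0 : c = 0 := by
      ext x
      exact (Finsupp.mem_supported' R _).1 hc x fun h => hℓ ⟨_, h.2⟩
    rw [h0, map_zero]
    exact zero_mem _

end MagnitudePath

end

/-! The reachability chains of `Z_m` are compared with a much smaller filtered complex, the periodic
resolution of the trivial module over the cyclic group of order `m`. It has one basis element per
vertex in every degree, and its differentials alternate between a difference of neighbours and the
norm. A generator of degree `2i` gets length `mi` and one of degree `2i + 1` gets length `mi + 1`.

Both complexes contract to each vertex `x`: reachability chains by putting `x` in front of a tuple,
the periodic complex by summing along the path from `x`. These contractions need not preserve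
length, but they do not increase the weight, which is the distance from `x` to the base vertex plus
the length. A chain map is built degree by degree as in acyclic models: a basis element is sent to
the contraction, towards its own base vertex, of the image of its boundary. Relative to that vertex
its weight equals its length, and the triangle inequality carries weight bounds from one base vertex
to another, so the map respects the filtration. The same construction gives homotopies, and a
filtered homotopy equivalence induces isomorphisms on all pages `E^r` with `r ≥ 1`
(`reachability_page_equiv`). Magnitude homology is `E^1` (`MH_equiv_page_one`).

In the periodic complex each degree has a single length, so the pages can be read off. The
difference differentials drop length by `1` and the norm differentials by `m - 1`. Hence `E^1` is
the whole complex, `E^2` takes homology for the differences only and leaves one copy of `R` in each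
degree, nothing happens until `d^{m-1}`, and the norm then cancels everything outside degree zero.

An isomorphism of pages does not give equality of subquotients. For that, `d^r` is shown to vanish
on the reachability complex itself, because its source or target is zero, and
`pagesEqual_of_pageDiff_eq_zero` applies. -/

noncomputable section

namespace MagnitudePath

universe u v w

/-! ### Criteria for isomorphisms of subquotients. -/

section Subquotient

variable {R : Type v} [CommRing R] {M : Type u} [AddCommGroup M] [Module R M]
  {N : Type w} [AddCommGroup N] [Module R N]

theorem subquotient_subsingleton {Z B : Submodule R M} (h : Z ≤ B) :
    Subsingleton (Subquotient Z B) := by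
  rw [Submodule.Quotient.subsingleton_iff, Submodule.submoduleOf_eq_top]
  exact h

/-- A linear map that is surjective on `Z` and whose kernel meets `Z` in `B` identifies `Z / B` with
its target. -/
theorem subquotient_equiv_of_surjective {Z B : Submodule R M} (φ : M →ₗ[R] N)
    (hs : ∀ n, ∃ z ∈ Z, φ z = n) (hk : ∀ z ∈ Z, φ z = 0 ↔ z ∈ B) :
    Nonempty (Subquotient Z B ≃ₗ[R] N) := by
  have hker : B.submoduleOf Z = LinearMap.ker (φ.domRestrict Z) := by
    ext ⟨z, hz⟩
    exact (hk z hz).symm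
  have hsurj : Function.Surjective (φ.domRestrict Z) := fun n => by
    obtain ⟨z, hz, rfl⟩ := hs n
    exact ⟨⟨z, hz⟩, rfl⟩
  exact ⟨(Submodule.quotEquivOfEq _ _ hker).trans
    ((φ.domRestrict Z).quotKerEquivOfSurjective hsurj)⟩

/-- A criterion for a linear map to induce an isomorphism of subquotients. -/
theorem subquotient_equiv {Z B : Submodule R M} {Z' B' : Submodule R N} (φ : M →ₗ[R] N)
    (hZ : ∀ z ∈ Z, φ z ∈ Z') (hB : ∀ z ∈ Z, φ z ∈ B' ↔ z ∈ B)
    (hs : ∀ z' ∈ Z', ∃ z ∈ Z, z' - φ z ∈ B') :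
    Nonempty (Subquotient Z B ≃ₗ[R] Subquotient Z' B') := by
  let ψ : Z →ₗ[R] Subquotient Z' B' := Submodule.mkQ _ ∘ₗ φ.restrict hZ
  have hker : B.submoduleOf Z = LinearMap.ker ψ := by
    ext ⟨z, hz⟩
    rw [LinearMap.mem_ker, LinearMap.comp_apply, Submodule.mkQ_apply,
      Submodule.Quotient.mk_eq_zero]
    exact (hB z hz).symm
  have hsurj : Function.Surjective ψ := fun n => by
    obtain ⟨⟨z', hz'⟩, rfl⟩ := Submodule.mkQ_surjective _ n
    obtain ⟨z, hz, h⟩ := hs z' hz'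
    refine ⟨⟨z, hz⟩, ?_⟩
    rw [LinearMap.comp_apply, Submodule.mkQ_apply, Submodule.mkQ_apply, eq_comm,
      Submodule.Quotient.eq]
    exact h
  exact ⟨(Submodule.quotEquivOfEq _ _ hker).trans (ψ.quotKerEquivOfSurjective hsurj)⟩

end Subquotient

/-! ### Pages of a spectral sequence: functoriality, homotopy invariance, vanishing differentials.
-/

namespace FilteredComplex

variable {R : Type v} [CommRing R] {M : Type u} [AddCommGroup M] [Module R M]
  {N : Type w} [AddCommGroup N] [Module R N]
  (C : FilteredComplex R M) (D : FilteredComplex R N)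

theorem filt_le {p q : ℤ} (h : p ≤ q) (k : ℤ) : C.filt p k ≤ C.filt q k := by
  induction q, h using Int.leInduction with
  | base => exact le_rfl
  | succ q _ ih => exact ih.trans (by simpa using C.filt_mono (q + 1) k)

theorem mem_approxCycles {r p k : ℤ} {c : M} :
    c ∈ C.approxCycles r p k ↔ c ∈ C.filt p k ∧ C.d c ∈ C.filt (p - r) (k - 1) := Iff.rfl

variable {C D}

theorem map_mem_approxCycles {f : M →ₗ[R] N} (hd : ∀ c, f (C.d c) = D.d (f c))
    (hF : ∀ p k, ∀ c ∈ C.filt p k, f c ∈ D.filt p k) {r p k : ℤ} {c : M}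
    (hc : c ∈ C.approxCycles r p k) : f c ∈ D.approxCycles r p k :=
  ⟨hF _ _ _ hc.1, by
    rw [SetLike.mem_coe, Submodule.mem_comap, ← hd]
    exact hF _ _ _ hc.2⟩

theorem map_mem_pageZ {f : M →ₗ[R] N} (hd : ∀ c, f (C.d c) = D.d (f c))
    (hF : ∀ p k, ∀ c ∈ C.filt p k, f c ∈ D.filt p k) {r : ℕ} {p k : ℤ} {c : M}
    (hc : c ∈ C.pageZ r p k) : f c ∈ D.pageZ r p k := by
  obtain ⟨a, ha, b, hb, rfl⟩ := Submodule.mem_sup.1 hc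
  rw [map_add]
  exact Submodule.add_mem_sup (map_mem_approxCycles hd hF ha) (hF _ _ _ hb)

theorem map_mem_pageB {f : M →ₗ[R] N} (hd : ∀ c, f (C.d c) = D.d (f c))
    (hF : ∀ p k, ∀ c ∈ C.filt p k, f c ∈ D.filt p k) {r : ℕ} {p k : ℤ} {c : M}
    (hc : c ∈ C.pageB r p k) : f c ∈ D.pageB r p k := by
  obtain ⟨_, ⟨a, ha, rfl⟩, b, hb, rfl⟩ := Submodule.mem_sup.1 hc
  rw [map_add, hd]
  exact Submodule.add_mem_sup ⟨_, map_mem_approxCycles hd hF ha, rfl⟩ (hF _ _ _ hb)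

/-- A filtered null-homotopic map is zero on the pages from the first on. -/
theorem homotopy_mem_pageB {h : M →ₗ[R] M} (hF : ∀ p k, ∀ c ∈ C.filt p k, h c ∈ C.filt p (k + 1))
    {r : ℕ} (hr : 1 ≤ r) {p k : ℤ} {c : M} (hc : c ∈ C.pageZ r p k) :
    C.d (h c) + h (C.d c) ∈ C.pageB r p k := by
  have hdh : ∀ q, ∀ b ∈ C.filt q k, C.d (h b) ∈ C.filt q k := fun q b hb => by
    simpa using C.d_mem _ _ _ (hF _ _ _ hb)
  have hhd : ∀ q, ∀ b, C.d b ∈ C.filt q (k - 1) → h (C.d b) ∈ C.filt q k := fun q b hb => by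
    simpa using hF _ _ _ hb
  obtain ⟨a, ha, b, hb, rfl⟩ := Submodule.mem_sup.1 hc
  have e : C.d (h (a + b)) + h (C.d (a + b)) =
      C.d (h a) + (h (C.d a) + (C.d (h b) + h (C.d b))) := by
    simp only [map_add]; abel
  rw [e]
  refine Submodule.add_mem_sup ⟨h a, ⟨?_, ?_⟩, rfl⟩ (add_mem ?_ (add_mem ?_ ?_))
  -- Here `r ≥ 1` gives `p ≤ p + r - 1`; below it gives `p - r ≤ p - 1`, so that `h (C.d a)` falls
  -- into the lower filtration.
  · exact C.filt_le (by omega) _ (hF _ _ _ ha.1)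
  · rw [SetLike.mem_coe, Submodule.mem_comap, show p + (r : ℤ) - 1 - (r - 1) = p by ring,
      add_sub_cancel_right]
    exact hdh _ _ ha.1
  · exact C.filt_le (by omega) _ (hhd _ _ ha.2)
  · exact hdh _ _ hb
  · exact hhd _ _ (C.d_mem _ _ _ hb)

/-- A filtered homotopy equivalence induces isomorphisms on the pages from the first on. -/
theorem page_equiv {f : M →ₗ[R] N} {g : N →ₗ[R] M} {h : M →ₗ[R] M} {h' : N →ₗ[R] N}
    (hf : ∀ c, f (C.d c) = D.d (f c)) (hfF : ∀ p k, ∀ c ∈ C.filt p k, f c ∈ D.filt p k)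
    (hg : ∀ c, g (D.d c) = C.d (g c)) (hgF : ∀ p k, ∀ c ∈ D.filt p k, g c ∈ C.filt p k)
    (hh : ∀ c, C.d (h c) + h (C.d c) = g (f c) - c)
    (hhF : ∀ p k, ∀ c ∈ C.filt p k, h c ∈ C.filt p (k + 1))
    (hh' : ∀ c, D.d (h' c) + h' (D.d c) = f (g c) - c)
    (hhF' : ∀ p k, ∀ c ∈ D.filt p k, h' c ∈ D.filt p (k + 1))
    {r : ℕ} (hr : 1 ≤ r) (p k : ℤ) : Nonempty (C.Page r p k ≃ₗ[R] D.Page r p k) := by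
  refine subquotient_equiv f (fun z hz => map_mem_pageZ hf hfF hz) (fun z hz => ⟨fun h₁ => ?_,
    fun h₁ => map_mem_pageB hf hfF h₁⟩) fun z hz => ⟨g z, map_mem_pageZ hg hgF hz, ?_⟩
  · have h₂ := sub_mem (map_mem_pageB hg hgF h₁) (homotopy_mem_pageB hhF hr hz)
    rwa [hh, sub_sub_cancel] at h₂
  · have h₂ := neg_mem (homotopy_mem_pageB hhF' hr hz)
    rwa [hh', neg_sub] at h₂

theorem mem_pageB_of_pageDiff_eq_zero {r : ℕ} {p k : ℤ} (h : C.pageDiff r p k = 0) {c : M}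
    (hc : c ∈ C.approxCycles r p k) : C.d c ∈ C.pageB r (p - r) (k - 1) := by
  have := C.pageDiff_pageClass r p k ⟨c, hc⟩
  rw [h, LinearMap.zero_apply, eq_comm, pageClass_eq_zero_iff] at this
  exact this

theorem pageZ_succ_le (r : ℕ) (p k : ℤ) : C.pageZ (r + 1) p k ≤ C.pageZ r p k :=
  sup_le_sup_right (fun _ hc => ⟨hc.1, C.filt_le (by push_cast; omega) _ hc.2⟩) _

theorem pageB_le_succ (r : ℕ) (p k : ℤ) : C.pageB r p k ≤ C.pageB (r + 1) p k := by
  have h : C.approxCycles ((r : ℤ) - 1) (p + r - 1) (k + 1) ≤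
      C.approxCycles (((r + 1 : ℕ) : ℤ) - 1) (p + (r + 1 : ℕ) - 1) (k + 1) := fun _ hc =>
    ⟨C.filt_le (by push_cast; omega) _ hc.1, C.filt_le (by push_cast; omega) _ hc.2⟩
  exact sup_le_sup_right (Submodule.map_mono h) _

/-- If the differential `d^r` vanishes, then `E^{r+1} = E^r`. -/
theorem pagesEqual_of_pageDiff_eq_zero {r : ℕ} (h : ∀ p k, C.pageDiff r p k = 0) :
    C.PagesEqual r (r + 1) := by
  refine fun p k => ⟨le_antisymm (sup_le ?_ le_sup_right) (pageZ_succ_le r p k),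
    le_antisymm (pageB_le_succ r p k) (sup_le ?_ le_sup_right)⟩
  · intro c hc
    obtain ⟨_, ⟨b, hb, rfl⟩, e, he, hbe⟩ :=
      Submodule.mem_sup.1 (mem_pageB_of_pageDiff_eq_zero (h p k) hc)
    -- The vanishing of `d^r` on `c` provides `b` in `F_{p-1}` whose boundary agrees with that of
    -- `c` modulo `F_{p-r-1}`; thus `c - b` survives one page longer and has the same class.
    have hb' : b ∈ C.filt (p - 1) k := by
      have := hb.1
      rwa [show p - (r : ℤ) + r - 1 = p - 1 by ring, sub_add_cancel] at this
    refine Submodule.mem_sup.2 ⟨c - b, ⟨sub_mem hc.1 (C.filt_le (by omega) _ hb'), ?_⟩, b, hb',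
      sub_add_cancel _ _⟩
    rw [SetLike.mem_coe, Submodule.mem_comap, map_sub, ← hbe, add_sub_cancel_left]
    exact C.filt_le (by push_cast; omega) _ he
  · rintro _ ⟨c, hc, rfl⟩
    -- The new boundaries on page `r + 1` come from the sources of `d^r` in filtration `p + r`.
    have hc' : c ∈ C.approxCycles r (p + r) (k + 1) :=
      ⟨C.filt_le (by push_cast; omega) _ hc.1, C.filt_le (by push_cast; omega) _ hc.2⟩
    have := mem_pageB_of_pageDiff_eq_zero (h (p + r) (k + 1)) hc'
    rwa [add_sub_cancel_right, add_sub_cancel_right] at this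

end FilteredComplex

/-! ### Magnitude homology as the first page. -/

section Magnitude

variable {V : Type u} (R : Type v) [CommRing R] (G : Digraph V)

/-- The terms omitted from the magnitude differential are exactly those of strictly smaller length.
-/
theorem boundary_sub_magBoundary_mem {k ℓ : ℤ} {c : RC R G} (hc : c ∈ MC R G k ℓ) :
    boundary R G c - magBoundary R G c ∈ (reachability R G).filt (ℓ - 1) (k - 1) := by
  rw [← Finsupp.sum_single c, Finsupp.sum, map_sum, map_sum, ← Finset.sum_sub_distrib]
  refine Submodule.sum_mem _ fun x hx => ?_
  have hx' : x.degree = k ∧ (x.length : ℤ) = ℓ := hc hx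
  have hb := (Finsupp.mem_supported' R _).1 (boundary_single_mem R G x (c x))
  rw [magBoundary_eq_filter R G x.length _ (Finsupp.single_mem_supported R _ rfl)]
  refine (Finsupp.mem_supported' R _).2 fun y hy => ?_
  rw [Finsupp.sub_apply]
  by_cases hxy : y.length = x.length
  · rw [Finsupp.filter_apply_pos (fun y : Generator G => y.length = x.length) _ hxy, sub_self]
  · rw [Finsupp.filter_apply_neg (fun y : Generator G => y.length = x.length) _ hxy, sub_zero]
    refine hb y fun h => hy ⟨by rw [h.1, hx'.1], ?_⟩
    have := h.2
    omega

theorem magBoundary_mem {k ℓ : ℤ} {c : RC R G} (hc : c ∈ MC R G k ℓ) :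
    magBoundary R G c ∈ MC R G (k - 1) ℓ := by
  have h : magBoundary R G c ∈ magCycles R G (k - 1) ℓ :=
    magBoundaries_le_magCycles R G (k - 1) ℓ ⟨c, by simpa using hc, rfl⟩
  exact h.1

theorem MC_le_filt (k ℓ : ℤ) : MC R G k ℓ ≤ (reachability R G).filt ℓ k :=
  Finsupp.supported_mono fun _ hx => ⟨hx.1, hx.2.le⟩

theorem exists_MC_add_filt {k ℓ : ℤ} {c : RC R G} (hc : c ∈ (reachability R G).filt ℓ k) :
    ∃ a ∈ MC R G k ℓ, ∃ b ∈ (reachability R G).filt (ℓ - 1) k, a + b = c := by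
  rw [← Submodule.mem_sup, MC, reachability, ← Finsupp.supported_union]
  refine Finsupp.supported_mono (fun x hx => ?_) hc
  obtain ⟨h₁, h₂⟩ := hx
  by_cases h : (x.length : ℤ) = ℓ
  · exact Or.inl ⟨h₁, h⟩
  · exact Or.inr ⟨h₁, by omega⟩

theorem eq_zero_of_mem_MC_of_mem_filt {k ℓ : ℤ} {c : RC R G} (hc : c ∈ MC R G k ℓ)
    (hc' : c ∈ (reachability R G).filt (ℓ - 1) k) : c = 0 := by
  ext x
  by_contra h
  have h₁ : x.degree = k ∧ (x.length : ℤ) = ℓ := hc (Finsupp.mem_support_iff.2 h)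
  have h₂ : x.degree = k ∧ (x.length : ℤ) ≤ ℓ - 1 := hc' (Finsupp.mem_support_iff.2 h)
  omega

/-- Magnitude homology is the first page of the magnitude-path spectral sequence. -/
theorem MH_equiv_page_one (k ℓ : ℤ) :
    Nonempty (MH R G k ℓ ≃ₗ[R] (reachability R G).Page 1 ℓ k) := by
  set C := reachability R G
  have hBd : ∀ c ∈ MC R G (k + 1) ℓ, C.d c - magBoundary R G c ∈ C.filt (ℓ - 1) k := by
    intro c hc
    have h := boundary_sub_magBoundary_mem R G hc
    rwa [add_sub_cancel_right] at h
  refine subquotient_equiv LinearMap.id (fun z hz => ?_) (fun z hz => ⟨fun h => ?_, ?_⟩)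
    fun z hz => ?_
  · refine Submodule.mem_sup_left ⟨MC_le_filt R G k ℓ hz.1, ?_⟩
    have := boundary_sub_magBoundary_mem R G hz.1
    rw [LinearMap.mem_ker.1 hz.2, sub_zero] at this
    exact this
  · obtain ⟨_, ⟨b, hb, rfl⟩, e, he, hbe⟩ := Submodule.mem_sup.1 h
    have hb' : b ∈ C.filt ℓ (k + 1) := by simpa using hb.1
    obtain ⟨b₁, hb₁, b₂, hb₂, rfl⟩ := exists_MC_add_filt R G hb'
    refine ⟨b₁, hb₁, ?_⟩
    have hm : magBoundary R G b₁ ∈ MC R G k ℓ := by simpa using magBoundary_mem R G hb₁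
    -- Both sides consist of terms of length exactly `ℓ`, so it is enough to compare them modulo
    -- smaller length.
    refine sub_eq_zero.1 (eq_zero_of_mem_MC_of_mem_filt R G (sub_mem hm hz.1) ?_)
    have h₂ : C.d b₂ ∈ C.filt (ℓ - 1) k := by simpa using C.d_mem _ _ _ hb₂
    have h₃ : magBoundary R G b₁ - z = -(C.d b₁ - magBoundary R G b₁) - C.d b₂ - e +
        (C.d b₁ + C.d b₂ + e - z) := by abel
    rw [h₃, ← map_add]
    have h₄ : C.d (b₁ + b₂) + e - z = 0 := sub_eq_zero.2 hbe
    rw [h₄, add_zero]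
    exact sub_mem (sub_mem (neg_mem (hBd _ hb₁)) h₂) he
  · rintro ⟨b, hb, rfl⟩
    have h₁ : (LinearMap.id : RC R G →ₗ[R] RC R G) (magBoundary R G b) =
      C.d b + -(C.d b - magBoundary R G b) := by rw [LinearMap.id_apply]; abel
    rw [h₁]
    refine Submodule.add_mem_sup ⟨b, ⟨?_, ?_⟩, rfl⟩ (neg_mem (hBd _ hb))
    · simpa using MC_le_filt R G _ _ hb
    · simpa using C.d_mem _ _ _ (MC_le_filt R G _ _ hb)
  · obtain ⟨a, ha, b, hb, rfl⟩ := Submodule.mem_sup.1 hz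
    obtain ⟨a₁, ha₁, a₂, ha₂, rfl⟩ := exists_MC_add_filt R G ha.1
    refine ⟨a₁, ⟨ha₁, ?_⟩, Submodule.mem_sup_right ?_⟩
    · refine LinearMap.mem_ker.2 (eq_zero_of_mem_MC_of_mem_filt R G (magBoundary_mem R G ha₁) ?_)
      have h₁ := boundary_sub_magBoundary_mem R G ha₁
      have h₂ : C.d (a₁ + a₂) ∈ C.filt (ℓ - 1) (k - 1) := ha.2
      have h₃ := C.d_mem _ _ _ ha₂
      have h₄ : magBoundary R G a₁ = C.d (a₁ + a₂) - C.d a₂ - (C.d a₁ - magBoundary R G a₁) := by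
        rw [map_add]; abel
      rw [h₄]
      exact sub_mem (sub_mem h₂ h₃) h₁
    · rw [LinearMap.id_apply, add_assoc, add_sub_cancel_left]
      exact add_mem ha₂ hb

end Magnitude

/-! ### Linear maps on graded free modules defined by recursion on the degree. -/

section Recursion

variable {R : Type v} [CommRing R] {B : Type u} {N : Type w} [AddCommGroup N] [Module R N]

theorem linearMap_congr_supported {s : Set B} {f g : (B →₀ R) →ₗ[R] N}
    (h : ∀ b ∈ s, f (Finsupp.single b 1) = g (Finsupp.single b 1)) {c : B →₀ R}
    (hc : c ∈ Finsupp.supported R R s) : f c = g c := by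
  rw [Finsupp.supported_eq_span_single] at hc
  exact LinearMap.eqOn_span (by rintro _ ⟨b, hb, rfl⟩; exact h b hb) hc

theorem linearMap_mem_of_supported {s : Set B} {P : Submodule R N} {f : (B →₀ R) →ₗ[R] N}
    (h : ∀ b ∈ s, f (Finsupp.single b 1) ∈ P) {c : B →₀ R}
    (hc : c ∈ Finsupp.supported R R s) : f c ∈ P := by
  rw [Finsupp.supported_eq_span_single] at hc
  exact (Submodule.span_le (p := P.comap f)).2 (by rintro _ ⟨b, hb, rfl⟩; exact h b hb) hc

/-- Definition of a linear map on a graded free module by recursion along a map `d` that lowers the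
degree. -/
theorem exists_linearMap_rec (deg : B → ℕ) (d : (B →₀ R) →ₗ[R] (B →₀ R))
    (hd : ∀ b, d (Finsupp.single b 1) ∈ Finsupp.supported R R {b' | deg b' + 1 = deg b})
    (Φ : B → N → N) :
    ∃ F : (B →₀ R) →ₗ[R] N,
      ∀ b, F (Finsupp.single b 1) = Φ b (F (d (Finsupp.single b 1))) := by
  -- The `n`-th approximation is correct on basis elements of degree below `n`. The starting value
  -- `0` does no harm, since `d` kills basis elements of degree zero.
  let f : ℕ → ((B →₀ R) →ₗ[R] N) := fun n => Nat.rec 0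
    (fun _ g => Finsupp.linearCombination R fun b => Φ b (g (d (Finsupp.single b 1)))) n
  have hf : ∀ n b, f (n + 1) (Finsupp.single b 1) = Φ b (f n (d (Finsupp.single b 1))) := by
    intro n b
    simp [f, Finsupp.linearCombination_single]
  have hstab : ∀ n b, deg b < n → f n (Finsupp.single b 1) = f (n + 1) (Finsupp.single b 1) := by
    intro n
    induction n with
    | zero => intro b hb; omega
    | succ n ih =>
      intro b hb
      rw [hf n b, hf (n + 1) b]
      congr 1
      refine linearMap_congr_supported (fun b' hb' => ih b' (by
          have : deg b' + 1 = deg b := hb'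
          omega))
        (hd b)
  have hF : ∀ b, Finsupp.linearCombination R (fun b => f (deg b + 1) (Finsupp.single b 1))
      (Finsupp.single b 1) = f (deg b + 1) (Finsupp.single b 1) := fun b => by
    rw [Finsupp.linearCombination_single, one_smul]
  refine ⟨Finsupp.linearCombination R fun b => f (deg b + 1) (Finsupp.single b 1), fun b => ?_⟩
  rw [hF, hf]
  congr 1
  refine linearMap_congr_supported (fun b' hb' => ?_) (hd b)
  rw [hF, show deg b' + 1 = deg b from hb']

end Recursion

/-! ### Comparison of filtered complexes with pointed contractions. -/

/-- Contractions of a filtered complex with a basis, one for every point of the space `X` with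
distance function `δ`. Each basis element `b` has a base point, and the contraction to `x` does not
increase the weight `δ x (base b) + len b`. -/
structure PointedContraction {R : Type v} [CommRing R] {B : Type u} {X : Type w}
    (C : FilteredComplex R (B →₀ R)) (δ : X → X → ℕ) where
  deg : B → ℕ
  len : B → ℕ
  base : B → X
  pt : X → B
  s : X → (B →₀ R) →ₗ[R] (B →₀ R)
  filt_eq : ∀ p k, C.filt p k = Finsupp.supported R R {b | (deg b : ℤ) = k ∧ (len b : ℤ) ≤ p}
  deg_pt : ∀ x, deg (pt x) = 0
  len_pt : ∀ x, len (pt x) = 0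
  base_pt : ∀ x, base (pt x) = x
  pt_base : ∀ b, deg b = 0 → pt (base b) = b
  d_mem : ∀ x b, C.d (Finsupp.single b 1) ∈ Finsupp.supported R R
    {b' | deg b' + 1 = deg b ∧ δ x (base b') + len b' ≤ δ x (base b) + len b}
  s_mem : ∀ x b, s x (Finsupp.single b 1) ∈ Finsupp.supported R R
    {b' | deg b' = deg b + 1 ∧ δ x (base b') + len b' ≤ δ x (base b) + len b}
  aug_d : ∀ b, deg b = 1 →
    Finsupp.linearCombination R (fun _ => (1 : R)) (C.d (Finsupp.single b 1)) = 0
  d_s_zero : ∀ x b, deg b = 0 →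
    C.d (s x (Finsupp.single b 1)) = Finsupp.single b 1 - Finsupp.single (pt x) 1
  d_s : ∀ x b, deg b ≠ 0 →
    C.d (s x (Finsupp.single b 1)) + s x (C.d (Finsupp.single b 1)) = Finsupp.single b 1

namespace PointedContraction

variable {R : Type v} [CommRing R] {B B' : Type u} {X : Type w} {δ : X → X → ℕ}
  {C : FilteredComplex R (B →₀ R)} {C' : FilteredComplex R (B' →₀ R)}
  (K : PointedContraction C δ) (K' : PointedContraction C' δ)

/-- The chains of degree `n` and of weight at most `p` relative to `x`. -/
def weightFilt (x : X) (p n : ℕ) : Submodule R (B →₀ R) :=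
  Finsupp.supported R R {b | K.deg b = n ∧ δ x (K.base b) + K.len b ≤ p}

variable {K K'}

theorem supported_le_weightFilt {t : Set B} {x : X} {p n : ℕ}
    (h : ∀ b ∈ t, K.deg b = n ∧ δ x (K.base b) + K.len b ≤ p) :
    Finsupp.supported R R t ≤ K.weightFilt x p n :=
  Finsupp.supported_mono h

theorem single_mem_weightFilt (x : X) (b : B) :
    Finsupp.single b 1 ∈ K.weightFilt x (δ x (K.base b) + K.len b) (K.deg b) :=
  Finsupp.single_mem_supported R _ ⟨rfl, le_rfl⟩

theorem d_mem_weightFilt (x : X) {b : B} {n : ℕ} (hn : K.deg b = n + 1) :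
    C.d (Finsupp.single b 1) ∈ K.weightFilt x (δ x (K.base b) + K.len b) n :=
  supported_le_weightFilt (fun b' hb => ⟨by have := hb.1; omega, hb.2⟩) (K.d_mem x b)

theorem d_eq_zero {b : B} (hb : K.deg b = 0) : C.d (Finsupp.single b 1) = 0 := by
  ext b'
  exact (Finsupp.mem_supported' R _).1 (K.d_mem (K.base b) b) b' fun h => by
    have := h.1
    omega

theorem s_mem_weightFilt {x : X} {p n : ℕ} {c : B →₀ R} (hc : c ∈ K.weightFilt x p n) :
    K.s x c ∈ K.weightFilt x p (n + 1) :=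
  linearMap_mem_of_supported (fun b hb => supported_le_weightFilt
    (fun b' hb' => ⟨by rw [hb'.1, hb.1], hb'.2.trans hb.2⟩) (K.s_mem x b)) hc

theorem d_s_of_cycle {x : X} {p n : ℕ} {c : B →₀ R} (hc : c ∈ K.weightFilt x p (n + 1))
    (h : C.d c = 0) : C.d (K.s x c) = c := by
  have := linearMap_congr_supported (f := C.d ∘ₗ K.s x + K.s x ∘ₗ C.d) (g := LinearMap.id)
    (fun b (hb : K.deg b = n + 1 ∧ _) => K.d_s x b (by omega)) hc
  simpa [h] using this

/-- In degree zero the contraction retracts onto a point: `d s c` is `c` minus the coefficient sum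
of `c` times `pt x`. The vanishing of that sum plays the role of the cycle condition. -/
theorem d_s_of_aug {x : X} {p : ℕ} {c : B →₀ R} (hc : c ∈ K.weightFilt x p 0)
    (h : Finsupp.linearCombination R (fun _ => (1 : R)) c = 0) : C.d (K.s x c) = c := by
  have := linearMap_congr_supported (f := C.d ∘ₗ K.s x) (g := LinearMap.id -
      (Finsupp.linearCombination R fun _ => (1 : R)).smulRight (Finsupp.single (K.pt x) (1 : R)))
    (fun b (hb : K.deg b = 0 ∧ _) => by simp [K.d_s_zero x b hb.1]) hc
  simpa [h] using this

/-- A map that does not increase the weight of basis elements relative to their own base points does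
not increase weights relative to any point. -/
theorem map_mem_weightFilt_of_base (htri : ∀ x y z, δ x z ≤ δ x y + δ y z)
    {F : (B →₀ R) →ₗ[R] (B' →₀ R)} {n n' : ℕ}
    (hF : ∀ b, K.deg b = n → F (Finsupp.single b 1) ∈ K'.weightFilt (K.base b) (K.len b) n')
    {x : X} {p : ℕ} {c : B →₀ R} (hc : c ∈ K.weightFilt x p n) : F c ∈ K'.weightFilt x p n' := by
  refine linearMap_mem_of_supported (fun b hb => supported_le_weightFilt (fun b' hb' => ⟨hb'.1, ?_⟩)
    (hF b hb.1)) hc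
  have h₁ := htri x (K.base b) (K'.base b')
  have h₂ := hb'.2
  have h₃ := hb.2
  omega

/-- The weight relative to any point is at least the length, as distances are nonnegative; weight
bounds at base points therefore control the filtration. -/
theorem map_mem_filt_of_base {F : (B →₀ R) →ₗ[R] (B' →₀ R)} {j : ℕ}
    (hF : ∀ b, F (Finsupp.single b 1) ∈ K'.weightFilt (K.base b) (K.len b) (K.deg b + j))
    (p k : ℤ) (c : B →₀ R) (hc : c ∈ C.filt p k) : F c ∈ C'.filt p (k + j) := by
  rw [K.filt_eq] at hc
  rw [K'.filt_eq]
  refine linearMap_mem_of_supported (fun b hb => Finsupp.supported_mono (fun b' hb' => ?_)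
    (hF b)) hc
  obtain ⟨h₁, h₂⟩ := hb
  obtain ⟨h₃, h₄⟩ := hb'
  constructor <;> omega

variable (K K')

/-- Comparison of complexes with contractions: existence of a filtered chain map. -/
theorem exists_map (hδ : ∀ x, δ x x = 0) (htri : ∀ x y z, δ x z ≤ δ x y + δ y z) :
    ∃ F : (B →₀ R) →ₗ[R] (B' →₀ R), (∀ c, F (C.d c) = C'.d (F c)) ∧
      (∀ b, F (Finsupp.single b 1) ∈ K'.weightFilt (K.base b) (K.len b) (K.deg b)) ∧
      ∀ x, F (Finsupp.single (K.pt x) 1) = Finsupp.single (K'.pt x) 1 := by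
  classical
  obtain ⟨F, hF⟩ := exists_linearMap_rec K.deg C.d
    (fun b => Finsupp.supported_mono (fun _ h => h.1) (K.d_mem (K.base b) b))
    -- Points go to points; in higher degree the image of the boundary is filled in by the
    -- contraction towards the base point of `b` itself.
    (fun b z => if K.deg b = 0 then Finsupp.single (K'.pt (K.base b)) (1 : R)
      else K'.s (K.base b) z)
  have hF0 : ∀ b, K.deg b = 0 → F (Finsupp.single b 1) = Finsupp.single (K'.pt (K.base b)) 1 :=
    fun b hb => by rw [hF, if_pos hb]
  have hF1 : ∀ b n, K.deg b = n + 1 →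
      F (Finsupp.single b 1) = K'.s (K.base b) (F (C.d (Finsupp.single b 1))) :=
    fun b n hb => by rw [hF, if_neg (by omega)]
  have hmem : ∀ n b, K.deg b = n →
      F (Finsupp.single b 1) ∈ K'.weightFilt (K.base b) (K.len b) n := by
    intro n
    induction n with
    | zero =>
      intro b hb
      rw [hF0 b hb]
      exact Finsupp.single_mem_supported R _
        ⟨K'.deg_pt _, by rw [K'.base_pt, K'.len_pt, hδ]; omega⟩
    | succ n ih =>
      intro b hb
      rw [hF1 b n hb]
      have h := d_mem_weightFilt (K.base b) hb
      rw [hδ, zero_add] at h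
      exact s_mem_weightFilt (map_mem_weightFilt_of_base htri ih h)
  have hcomm : ∀ n b, K.deg b = n →
      F (C.d (Finsupp.single b 1)) = C'.d (F (Finsupp.single b 1)) := by
    intro n
    induction n with
    | zero =>
      intro b hb
      rw [hF0 b hb, d_eq_zero hb, d_eq_zero (K'.deg_pt _), map_zero]
    | succ n ih =>
      intro b hb
      have h := map_mem_weightFilt_of_base htri (hmem n) (d_mem_weightFilt (K.base b) hb)
      rw [hF1 b n hb]
      cases n with
      | zero =>
        -- In degree one the boundary lands in degree zero, where filling requires coefficient sum
        -- zero; `F` preserves that sum since it sends points to points.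
        refine (d_s_of_aug h ?_).symm
        rw [← K.aug_d b hb]
        exact linearMap_congr_supported (f := Finsupp.linearCombination R (fun _ => (1 : R)) ∘ₗ F)
          (fun b' hb' => by simp [hF0 b' hb'.1]) (d_mem_weightFilt (K.base b) hb)
      | succ n =>
        refine (d_s_of_cycle h ?_).symm
        rw [← LinearMap.comp_apply, linearMap_congr_supported (g := F ∘ₗ C.d)
          (fun b' hb' => (ih b' hb'.1).symm) (d_mem_weightFilt (K.base b) hb),
          LinearMap.comp_apply, C.d_d, map_zero]
  refine ⟨F, fun c => ?_, fun b => hmem _ b rfl, fun x => ?_⟩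
  · refine linearMap_congr_supported (s := Set.univ) (f := F ∘ₗ C.d) (g := C'.d ∘ₗ F)
      (fun b _ => hcomm _ b rfl) (by simp)
  · rw [hF0 _ (K.deg_pt x), K.base_pt]

/-- Comparison of complexes with contractions: uniqueness of filtered chain maps up to filtered
homotopy. -/
theorem exists_homotopy (hδ : ∀ x, δ x x = 0) (htri : ∀ x y z, δ x z ≤ δ x y + δ y z)
    {F G : (B →₀ R) →ₗ[R] (B' →₀ R)}
    (hF : ∀ c, F (C.d c) = C'.d (F c)) (hG : ∀ c, G (C.d c) = C'.d (G c))
    (hFm : ∀ b, F (Finsupp.single b 1) ∈ K'.weightFilt (K.base b) (K.len b) (K.deg b))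
    (hGm : ∀ b, G (Finsupp.single b 1) ∈ K'.weightFilt (K.base b) (K.len b) (K.deg b))
    (h0 : ∀ x, F (Finsupp.single (K.pt x) 1) = G (Finsupp.single (K.pt x) 1)) :
    ∃ H : (B →₀ R) →ₗ[R] (B' →₀ R), (∀ c, C'.d (H c) + H (C.d c) = F c - G c) ∧
      ∀ b, H (Finsupp.single b 1) ∈ K'.weightFilt (K.base b) (K.len b) (K.deg b + 1) := by
  obtain ⟨H, hH⟩ := exists_linearMap_rec K.deg C.d
    (fun b => Finsupp.supported_mono (fun _ h => h.1) (K.d_mem (K.base b) b))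
    -- With `z = H (d b)` the argument is a cycle in positive degree, and filling it gives the
    -- homotopy identity. In degree zero it vanishes because `F` and `G` agree on points.
    (fun b z => K'.s (K.base b) (F (Finsupp.single b 1) - G (Finsupp.single b 1) - z))
  have hH0 : ∀ b, K.deg b = 0 → H (Finsupp.single b 1) = 0 := by
    intro b hb
    have := h0 (K.base b)
    rw [K.pt_base b hb] at this
    rw [hH, this, d_eq_zero hb, sub_self, map_zero, sub_zero, map_zero]
  have hmem : ∀ n b, K.deg b = n →
      F (Finsupp.single b 1) - G (Finsupp.single b 1) - H (C.d (Finsupp.single b 1)) ∈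
        K'.weightFilt (K.base b) (K.len b) n ∧
      H (Finsupp.single b 1) ∈ K'.weightFilt (K.base b) (K.len b) (n + 1) := by
    intro n
    induction n with
    | zero =>
      intro b hb
      rw [hH0 b hb, d_eq_zero hb, map_zero, sub_zero, ← hb]
      exact ⟨sub_mem (hFm b) (hGm b), zero_mem _⟩
    | succ n ih =>
      intro b hb
      have h := d_mem_weightFilt (K.base b) hb
      rw [hδ, zero_add] at h
      have h' : F (Finsupp.single b 1) - G (Finsupp.single b 1) - H (C.d (Finsupp.single b 1)) ∈
          K'.weightFilt (K.base b) (K.len b) (n + 1) := by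
        rw [← hb]
        refine sub_mem (sub_mem (hFm b) (hGm b)) ?_
        rw [hb]
        exact map_mem_weightFilt_of_base htri (fun b' hb' => (ih b' hb').2) h
      refine ⟨h', ?_⟩
      rw [hH]
      exact s_mem_weightFilt h'
  have hcomm : ∀ n b, K.deg b = n →
      C'.d (H (Finsupp.single b 1)) + H (C.d (Finsupp.single b 1)) =
        F (Finsupp.single b 1) - G (Finsupp.single b 1) := by
    intro n
    induction n with
    | zero =>
      intro b hb
      have := h0 (K.base b)
      rw [K.pt_base b hb] at this
      rw [hH0 b hb, d_eq_zero hb, this, map_zero, map_zero, sub_self, add_zero]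
    | succ n ih =>
      intro b hb
      have h := linearMap_congr_supported (f := C'.d ∘ₗ H + H ∘ₗ C.d) (g := F - G)
        (fun b' hb' => ih b' hb'.1) (d_mem_weightFilt (K.base b) hb)
      simp only [LinearMap.add_apply, LinearMap.comp_apply, C.d_d, map_zero, add_zero,
        LinearMap.sub_apply] at h
      rw [hH, d_s_of_cycle ((hmem _ b hb).1), sub_add_cancel]
      rw [map_sub, map_sub, h, hF, hG, sub_self]
  refine ⟨H, fun c => ?_, fun b => (hmem _ b rfl).2⟩
  exact linearMap_congr_supported (s := Set.univ) (f := C'.d ∘ₗ H + H ∘ₗ C.d) (g := F - G)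
      (fun b _ => hcomm _ b rfl) (by simp)

theorem single_mem_weightFilt_base (hδ : ∀ x, δ x x = 0) (b : B) :
    Finsupp.single b 1 ∈ K.weightFilt (K.base b) (K.len b) (K.deg b) := by
  have := single_mem_weightFilt (K := K) (K.base b) b
  rwa [hδ, zero_add] at this

/-- Filtered complexes with contractions over the same space have isomorphic pages from the first
on. -/
theorem page_equiv (K : PointedContraction C δ) (K' : PointedContraction C' δ)
    (hδ : ∀ x, δ x x = 0) (htri : ∀ x y z, δ x z ≤ δ x y + δ y z)
    {r : ℕ} (hr : 1 ≤ r) (p k : ℤ) : Nonempty (C.Page r p k ≃ₗ[R] C'.Page r p k) := by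
  -- Uniqueness up to homotopy, applied to `g ∘ f` and the identity; it is used for both composites.
  have hcomp : ∀ {B₁ B₂ : Type u} {C₁ : FilteredComplex R (B₁ →₀ R)}
      {C₂ : FilteredComplex R (B₂ →₀ R)} (K₁ : PointedContraction C₁ δ)
      (K₂ : PointedContraction C₂ δ) (f : (B₁ →₀ R) →ₗ[R] (B₂ →₀ R))
      (g : (B₂ →₀ R) →ₗ[R] (B₁ →₀ R)), (∀ c, f (C₁.d c) = C₂.d (f c)) →
      (∀ c, g (C₂.d c) = C₁.d (g c)) →
      (∀ b, f (Finsupp.single b 1) ∈ K₂.weightFilt (K₁.base b) (K₁.len b) (K₁.deg b)) →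
      (∀ b, g (Finsupp.single b 1) ∈ K₁.weightFilt (K₂.base b) (K₂.len b) (K₂.deg b)) →
      (∀ x, f (Finsupp.single (K₁.pt x) 1) = Finsupp.single (K₂.pt x) 1) →
      (∀ x, g (Finsupp.single (K₂.pt x) 1) = Finsupp.single (K₁.pt x) 1) →
      ∃ h : (B₁ →₀ R) →ₗ[R] (B₁ →₀ R), (∀ c, C₁.d (h c) + h (C₁.d c) = g (f c) - c) ∧
        ∀ p k, ∀ c ∈ C₁.filt p k, h c ∈ C₁.filt p (k + 1) := by
    intro B₁ B₂ C₁ C₂ K₁ K₂ f g hf hg hfm hgm hf0 hg0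
    obtain ⟨h, hh, hhm⟩ := exists_homotopy K₁ K₁ hδ htri (F := g ∘ₗ f) (G := LinearMap.id)
      (fun c => by simp [hf, hg]) (fun c => rfl)
      (fun b => map_mem_weightFilt_of_base (K := K₂) htri (n := K₁.deg b)
        (fun b' hb' => by rw [← hb']; exact hgm b') (hfm b))
      (fun b => K₁.single_mem_weightFilt_base hδ b) (fun x => by simp [hf0, hg0])
    exact ⟨h, hh, fun p k c hc => by simpa using map_mem_filt_of_base hhm p k c hc⟩
  obtain ⟨f, hf, hfm, hf0⟩ := exists_map K K' hδ htri
  obtain ⟨g, hg, hgm, hg0⟩ := exists_map K' K hδ htri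
  obtain ⟨h, hh, hhF⟩ := hcomp K K' f g hf hg hfm hgm hf0 hg0
  obtain ⟨h', hh', hhF'⟩ := hcomp K' K g f hg hf hgm hfm hg0 hf0
  exact FilteredComplex.page_equiv hf
    (fun p k c hc => by simpa using map_mem_filt_of_base (j := 0) hfm p k c hc) hg
    (fun p k c hc => by simpa using map_mem_filt_of_base (j := 0) hgm p k c hc)
    hh hhF hh' hhF' hr p k

end PointedContraction

/-! ### Contractions of reachability chains by prepending a vertex. -/

section Reachability

variable {V : Type u} (R : Type v) [CommRing R] (G : Digraph V)

theorem dist_self (x : V) : dist G x x = 0 :=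
  Nat.sInf_eq_zero.2 (Or.inl (IsPath.nil x))

/-- The first entry of a generator. -/
def Generator.head {G : Digraph V} (l : Generator G) : V := l.1.head l.2.1

/-- This identifies the weight relative to `x` with the length of the prolonged tuple, whence
prepending `x` does not change it. -/
theorem tupleLength_cons_generator (x : V) (l : Generator G) :
    tupleLength G (x :: l.1) = dist G x l.head + l.length := by
  obtain ⟨_ | ⟨a, l⟩, hl⟩ := l
  · exact absurd rfl hl.1
  · rfl

/-- Prepending the vertex `x` to all generators, with the degenerate tuples omitted. -/
def prepend (x : V) : RC R G →ₗ[R] RC R G :=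
  Finsupp.linearCombination R (fun l : Generator G => toRC R G (Finsupp.single (x :: l.1) 1))

variable {R G}

theorem toRC_single_cons (x : V) {w : List V} (hw : w ≠ []) (c : R) :
    toRC R G (Finsupp.single (x :: w) c) = prepend R G x (toRC R G (Finsupp.single w c)) := by
  by_cases h : IsGenerator G w
  · rw [toRC_single R (⟨w, h⟩ : Generator G), prepend, Finsupp.linearCombination_single,
      ← map_smul, Finsupp.smul_single_one]
  · rw [toRC_single_of_not R h, map_zero]
    exact toRC_single_of_not R (fun h' => h ⟨hw, h'.2.1.tail, h'.2.2.tail⟩) c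

/-- Two entries are needed so that no face is empty: the empty tuple is not a generator, whereas
`[x]` is. -/
theorem toRC_cons_faces (x : V) {l : List V} (hl : 2 ≤ l.length) :
    toRC R G (Finsupp.lmapDomain R R (List.cons x) (faces R l)) =
      prepend R G x (toRC R G (faces R l)) := by
  simp only [faces, map_sum, Finsupp.lmapDomain_apply, Finsupp.mapDomain_single]
  refine Finset.sum_congr rfl fun i hi => toRC_single_cons x (fun h => ?_) _
  have := congrArg List.length h
  rw [List.length_eraseIdx_of_lt (Finset.mem_range.1 hi), List.length_nil] at this
  omega

theorem boundary_single_one (l : Generator G) :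
    boundary R G (Finsupp.single l 1) = toRC R G (faces R l.1) := by
  rw [boundary, Finsupp.linearCombination_single, one_smul]

theorem prepend_single_one (x : V) (l : Generator G) :
    prepend R G x (Finsupp.single l 1) = toRC R G (Finsupp.single (x :: l.1) 1) := by
  rw [prepend, Finsupp.linearCombination_single, one_smul]

/-- The formula persists if `x` is already the head of `l`, because `boundary_toRC_single` also
covers degenerate tuples; both sides are then zero. -/
theorem boundary_prepend (hG : ∀ x y, Reach G x y) (x : V) (l : Generator G) :
    boundary R G (prepend R G x (Finsupp.single l 1)) = Finsupp.single l 1 -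
      toRC R G (Finsupp.lmapDomain R R (List.cons x) (faces R l.1)) := by
  have hchain : (x :: l.1).IsChain (Reach G) :=
    List.isChain_iff_forall_rel_of_append_cons_cons.2 fun _ _ _ _ _ => hG _ _
  rw [prepend_single_one, boundary_toRC_single R G _ hchain, one_smul, faces_cons, map_sub,
    toRC_single]

variable (R) in
/-- If every vertex can be reached from every other one, then prepending vertices contracts the
reachability chains. -/
def reachabilityContraction (hG : ∀ x y, Reach G x y) :
    PointedContraction (reachability R G) (dist G) where
  deg l := l.1.length - 1
  len l := l.length
  base l := l.head
  pt x := ⟨[x], by simp [IsGenerator]⟩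
  s x := prepend R G x
  filt_eq p k := by
    refine congrArg (Finsupp.supported R R) (Set.ext fun l => ?_)
    have : 1 ≤ l.1.length := List.length_pos_iff.2 l.2.1
    simp only [Generator.degree, Set.mem_ofPred_eq]
    rw [Nat.cast_sub this, Nat.cast_one]
  deg_pt x := rfl
  len_pt x := rfl
  base_pt x := rfl
  pt_base l hl := by
    obtain ⟨_ | ⟨a, _ | ⟨b, l⟩⟩, hl'⟩ := l
    · exact absurd rfl hl'.1
    · rfl
    · simp at hl
  d_mem x l := by
    change boundary R G _ ∈ _
    rw [boundary_single_one, faces, map_sum]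
    refine Submodule.sum_mem _ fun i hi => ?_
    by_cases hg : IsGenerator G (l.1.eraseIdx i)
    · rw [toRC_single R (⟨_, hg⟩ : Generator G)]
      refine Finsupp.single_mem_supported R _ ⟨?_, ?_⟩
      · have h₁ := List.length_eraseIdx_of_lt (Finset.mem_range.1 hi)
        have h₂ := List.length_pos_iff.2 hg.1
        change (l.1.eraseIdx i).length - 1 + 1 = _
        omega
      -- The `i`-th face of `l` is the `(i + 1)`-st face of `x :: l`, so the weight bound is the
      -- length bound for omitting an entry.
      · rw [← tupleLength_cons_generator, ← tupleLength_cons_generator]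
        exact tupleLength_eraseIdx_le G (x :: l.1) (List.isChain_iff_forall_rel_of_append_cons_cons.2
          fun _ _ _ _ _ => hG _ _) (i + 1)
    · rw [toRC_single_of_not R hg]
      exact zero_mem _
  s_mem x l := by
    rw [prepend_single_one]
    by_cases hg : IsGenerator G (x :: l.1)
    · rw [toRC_single R (⟨_, hg⟩ : Generator G)]
      refine Finsupp.single_mem_supported R _ ⟨?_, ?_⟩
      · have := List.length_pos_iff.2 l.2.1
        simp only [List.length_cons]
        omega
      · change dist G x x + tupleLength G (x :: l.1) ≤ _
        rw [dist_self, zero_add, tupleLength_cons_generator]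
    · rw [toRC_single_of_not R hg]
      exact zero_mem _
  aug_d l hl := by
    change Finsupp.linearCombination R (fun _ => (1 : R)) (boundary R G _) = 0
    rw [boundary_single_one]
    obtain ⟨_ | ⟨a, _ | ⟨b, _ | ⟨c, l⟩⟩⟩, hl'⟩ := l
    · simp at hl
    · simp at hl
    · have h : ∀ x, toRC R G (Finsupp.single [x] 1) =
          Finsupp.single ⟨[x], by simp [IsGenerator]⟩ 1 :=
        fun x => toRC_single R (⟨[x], by simp [IsGenerator]⟩ : Generator G) 1
      simp [faces, Finset.sum_range_succ, h]
    · simp at hl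
  d_s_zero x l hl := by
    change boundary R G _ = _
    rw [boundary_prepend hG]
    obtain ⟨_ | ⟨a, _ | ⟨b, l⟩⟩, hl'⟩ := l
    · exact absurd rfl hl'.1
    · congr 1
      simp only [faces, List.length_cons, List.length_nil, zero_add, Finset.sum_range_one,
        List.eraseIdx_cons_zero, pow_zero, Finsupp.lmapDomain_apply, Finsupp.mapDomain_single]
      exact toRC_single R (⟨[x], by simp [IsGenerator]⟩ : Generator G) 1
    · simp at hl
  d_s x l hl := by
    change boundary R G _ + prepend R G x (boundary R G _) = _
    rw [boundary_prepend hG, boundary_single_one, toRC_cons_faces x (by omega), sub_add_cancel]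

end Reachability

/-! ### Distances in the directed cycle and sums over its vertices. -/

section DirectedCycle

theorem isPath_directedCycle {m n : ℕ} {x y : ZMod m} :
    IsPath (directedCycle m) n x y ↔ y = x + n := by
  constructor
  · intro h
    induction h with
    | nil x => simp
    | cons h _ ih =>
      rw [ih, show _ = _ from h]
      push_cast
      ring
  · rintro rfl
    induction n generalizing x with
    | zero => simpa using IsPath.nil x
    | succ n ih =>
      refine IsPath.cons (y := x + 1) rfl ?_
      have := ih (x := x + 1)
      rwa [show x + 1 + (n : ZMod m) = x + ((n + 1 : ℕ) : ZMod m) by push_cast; ring] at this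

variable {m : ℕ} [NeZero m]

theorem reach_directedCycle (x y : ZMod m) : Reach (directedCycle m) x y :=
  ⟨(y - x).val, isPath_directedCycle.2 (by simp)⟩

theorem dist_directedCycle (x y : ZMod m) : dist (directedCycle m) x y = (y - x).val := by
  refine le_antisymm (Nat.sInf_le (isPath_directedCycle.2 (by simp))) ?_
  have h := isPath_directedCycle.1 (isPath_dist (reach_directedCycle x y))
  conv_lhs => rw [h, add_sub_cancel_left, ZMod.val_natCast]
  exact Nat.mod_le _ _

end DirectedCycle

section ZModSum

variable {m : ℕ} [NeZero m]

theorem zmod_val_add_one (a : ZMod m) : (a + 1).val = (a.val + 1) % m := by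
  conv_lhs => rw [← ZMod.natCast_zmod_val a]
  rw [← Nat.cast_add_one, ZMod.val_natCast]

theorem sum_range_add_eq_sum_zmod {A : Type*} [AddCommMonoid A] (f : ZMod m → A) (x : ZMod m) :
    ∑ j ∈ Finset.range m, f (x + j) = ∑ z, f z :=
  Finset.sum_nbij' (fun j => x + j) (fun z => (z - x).val) (by simp)
    (fun z _ => Finset.mem_range.2 (ZMod.val_lt _))
    (fun j hj => by simp [ZMod.val_natCast, Nat.mod_eq_of_lt (Finset.mem_range.1 hj)])
    (fun z _ => by simp) (fun _ _ => rfl)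

end ZModSum

/-! ### The periodic complex and its contractions. -/

section Periodic

/-- The length of the generators of degree `n` of the periodic complex: `m i` for `n = 2 i` and
`m i + 1` for `n = 2 i + 1`. -/
def periodicLength (m n : ℕ) : ℕ := m * (n / 2) + n % 2

theorem periodicLength_succ_of_even (m : ℕ) {n : ℕ} (hn : Even n) :
    periodicLength m (n + 1) = periodicLength m n + 1 := by
  rw [Nat.even_iff] at hn
  rw [periodicLength, periodicLength, show (n + 1) / 2 = n / 2 by omega,
    show (n + 1) % 2 = 1 by omega, hn]

theorem periodicLength_succ_of_odd (m : ℕ) {n : ℕ} (hn : ¬ Even n) :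
    periodicLength m (n + 1) + 1 = periodicLength m n + m := by
  rw [Nat.even_iff] at hn
  rw [periodicLength, periodicLength, show (n + 1) / 2 = n / 2 + 1 by omega,
    show (n + 1) % 2 = 0 by omega, show n % 2 = 1 by omega]
  ring

variable (R : Type v) [CommRing R] {m : ℕ}

/-- The basis element of degree `n` at the vertex `x` of the periodic complex. -/
abbrev periodicBasis (n : ℕ) (x : ZMod m) : ℕ × ZMod m →₀ R := Finsupp.single (n, x) 1

/-- The contraction of the periodic complex to the vertex `x`, on basis elements. -/
def periodicSBasis (x : ZMod m) (b : ℕ × ZMod m) : ℕ × ZMod m →₀ R :=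
  -- Even degree: the edges of the path from `x` to `b.2`, whose boundaries telescope. Odd degree:
  -- nonzero only for `b.2 = x - 1`, the edge that closes the cycle at `x`.
  if Even b.1 then ∑ j ∈ Finset.range (b.2 - x).val, periodicBasis R (b.1 + 1) (x + j)
  else if (b.2 - x).val + 1 = m then periodicBasis R (b.1 + 1) x else 0

/-- The contraction of the periodic complex to the vertex `x`. -/
def periodicS (x : ZMod m) : (ℕ × ZMod m →₀ R) →ₗ[R] (ℕ × ZMod m →₀ R) :=
  Finsupp.linearCombination R (periodicSBasis R x)

theorem periodicS_of_even {n : ℕ} (hn : Even n) (x y : ZMod m) :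
    periodicS R x (periodicBasis R n y) =
      ∑ j ∈ Finset.range (y - x).val, periodicBasis R (n + 1) (x + (j : ZMod m)) := by
  rw [periodicS, Finsupp.linearCombination_single, one_smul, periodicSBasis, if_pos hn]

theorem periodicS_of_odd {n : ℕ} (hn : ¬ Even n) (x y : ZMod m) :
    periodicS R x (periodicBasis R n y) =
      if (y - x).val + 1 = m then periodicBasis R (n + 1) x else 0 := by
  rw [periodicS, Finsupp.linearCombination_single, one_smul, periodicSBasis, if_neg hn]

variable (m) [NeZero m]

variable {m} in
/-- The sum of all basis elements of degree `n` of the periodic complex. -/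
def periodicNorm (n : ℕ) : ℕ × ZMod m →₀ R := ∑ y : ZMod m, periodicBasis R n y

variable {m} in
/-- The differential of the periodic resolution of the trivial module over the cyclic group, on
basis elements. -/
def periodicDBasis : ℕ × ZMod m → (ℕ × ZMod m →₀ R)
  | (0, _) => 0
  | (n + 1, x) => if Even n then periodicBasis R n (x + 1) - periodicBasis R n x
      else periodicNorm R n

/-- The differential of the periodic resolution of the trivial module over the cyclic group. -/
def periodicD : (ℕ × ZMod m →₀ R) →ₗ[R] (ℕ × ZMod m →₀ R) :=
  Finsupp.linearCombination R (periodicDBasis R)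

variable {m}

theorem periodicD_single (b : ℕ × ZMod m) :
    periodicD R m (Finsupp.single b 1) = periodicDBasis R b := by
  rw [periodicD, Finsupp.linearCombination_single, one_smul]

theorem periodicD_zero (x : ZMod m) : periodicD R m (periodicBasis R 0 x) = 0 :=
  periodicD_single R _

/-- Here and in the odd case the parity is that of the target degree `n`. -/
theorem periodicD_succ_of_even {n : ℕ} (hn : Even n) (x : ZMod m) :
    periodicD R m (periodicBasis R (n + 1) x) =
      periodicBasis R n (x + 1) - periodicBasis R n x := by
  rw [periodicD_single, periodicDBasis, if_pos hn]

theorem periodicD_succ_of_odd {n : ℕ} (hn : ¬ Even n) (x : ZMod m) :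
    periodicD R m (periodicBasis R (n + 1) x) = periodicNorm R n := by
  rw [periodicD_single, periodicDBasis, if_neg hn]

theorem periodicD_periodicNorm {n : ℕ} (hn : Even n) :
    periodicD R m (periodicNorm R (n + 1)) = 0 := by
  rw [periodicNorm, map_sum]
  simp only [periodicD_succ_of_even R hn]
  rw [Finset.sum_sub_distrib, sub_eq_zero]
  exact Equiv.sum_comp (Equiv.addRight (1 : ZMod m)) (fun y => periodicBasis R n y)

theorem periodicD_periodicD (c : ℕ × ZMod m →₀ R) : periodicD R m (periodicD R m c) = 0 := by
  suffices h : periodicD R m ∘ₗ periodicD R m = 0 from LinearMap.congr_fun h c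
  refine Finsupp.lhom_ext' fun ⟨n, x⟩ => LinearMap.ext_ring ?_
  change periodicD R m (periodicD R m (periodicBasis R n x)) = 0
  match n with
  | 0 => rw [periodicD_zero, map_zero]
  | 1 => rw [periodicD_succ_of_even R Even.zero, map_sub, periodicD_zero, periodicD_zero, sub_self]
  | n + 2 =>
    by_cases hn : Even n
    · rw [periodicD_succ_of_odd R (Nat.even_add_one.not.2 (not_not.2 hn)),
        periodicD_periodicNorm R hn]
    · rw [periodicD_succ_of_even R (Nat.even_add_one.2 hn), map_sub, periodicD_succ_of_odd R hn,
        periodicD_succ_of_odd R hn, sub_self]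

theorem periodicNorm_mem_supported {n : ℕ} {s : Set (ℕ × ZMod m)} (h : ∀ y, (n, y) ∈ s) :
    periodicNorm R n ∈ Finsupp.supported R R s :=
  Submodule.sum_mem _ fun y _ => Finsupp.single_mem_supported R _ (h y)

/-- A step to `y + 1` adds at most `1` to the distance, and the norm reaches vertices at distance at
most `m - 1`; these are precisely the drops in length. -/
theorem periodicD_mem_supported (x : ZMod m) (b : ℕ × ZMod m) :
    periodicD R m (Finsupp.single b 1) ∈ Finsupp.supported R R
      {b' | b'.1 + 1 = b.1 ∧ dist (directedCycle m) x b'.2 + periodicLength m b'.1 ≤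
        dist (directedCycle m) x b.2 + periodicLength m b.1} := by
  have hm := NeZero.pos m
  obtain ⟨_ | n, y⟩ := b
  · rw [periodicD_zero]
    exact zero_mem _
  · by_cases hn : Even n
    · rw [periodicD_succ_of_even R hn]
      have h := periodicLength_succ_of_even m hn
      refine sub_mem (Finsupp.single_mem_supported R _ ⟨rfl, ?_⟩)
        (Finsupp.single_mem_supported R _ ⟨rfl, ?_⟩)
      · dsimp only
        rw [dist_directedCycle, dist_directedCycle, h, show y + 1 - x = y - x + 1 by ring,
          zmod_val_add_one]
        have := Nat.mod_le ((y - x).val + 1) m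
        omega
      · dsimp only
        omega
    · rw [periodicD_succ_of_odd R hn]
      refine periodicNorm_mem_supported R fun z => ⟨rfl, ?_⟩
      have h := periodicLength_succ_of_odd m hn
      have := ZMod.val_lt (z - x)
      dsimp only
      rw [dist_directedCycle]
      omega

variable (m) in
/-- The periodic resolution of the trivial module over the cyclic group of order `m`, filtered by
length. -/
def periodicComplex : FilteredComplex R (ℕ × ZMod m →₀ R) where
  d := periodicD R m
  filt p k := Finsupp.supported R R {b | (b.1 : ℤ) = k ∧ (periodicLength m b.1 : ℤ) ≤ p}
  d_d := periodicD_periodicD R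
  filt_mono p k := Finsupp.supported_mono fun b hb => ⟨hb.1, by have := hb.2; omega⟩
  d_mem p k c hc := by
    refine linearMap_mem_of_supported (fun b hb => ?_) hc
    refine Finsupp.supported_mono (fun b' hb' => ?_) (periodicD_mem_supported R b.2 b)
    obtain ⟨h₁, h₂⟩ := hb
    obtain ⟨h₃, h₄⟩ := hb'
    rw [dist_self] at h₄
    constructor <;> omega

theorem periodicD_periodicS_of_even {n : ℕ} (hn : Even n) (x y : ZMod m) :
    periodicD R m (periodicS R x (periodicBasis R n y)) =
      periodicBasis R n y - periodicBasis R n x := by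
  rw [periodicS_of_even R hn, map_sum]
  simp only [periodicD_succ_of_even R hn]
  have h := Finset.sum_range_sub (fun j : ℕ => periodicBasis R n (x + (j : ZMod m))) (y - x).val
  simp only [ZMod.natCast_val, ZMod.cast_id', id_eq, add_sub_cancel, Nat.cast_zero, add_zero,
    Nat.cast_add, Nat.cast_one, ← add_assoc] at h
  exact h

theorem periodicD_periodicS_of_odd {n : ℕ} (hn : ¬ Even n) (x y : ZMod m) :
    periodicD R m (periodicS R x (periodicBasis R n y)) =
      if (y - x).val + 1 = m then periodicNorm R n else 0 := by
  rw [periodicS_of_odd R hn]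
  split_ifs
  · rw [periodicD_succ_of_odd R hn]
  · rw [map_zero]

theorem periodicS_periodicNorm_of_odd {n : ℕ} (hn : ¬ Even n) (x : ZMod m) :
    periodicS R x (periodicNorm R n) = periodicBasis R (n + 1) x := by
  rw [periodicNorm, map_sum]
  simp only [periodicS_of_odd R hn]
  rw [Finset.sum_eq_single (x - 1)]
  · rw [if_pos]
    have h := zmod_val_add_one (x - 1 - x)
    rw [show x - 1 - x + 1 = 0 by ring, ZMod.val_zero] at h
    have h₁ := ZMod.val_lt (x - 1 - x)
    have h₂ := Nat.dvd_of_mod_eq_zero h.symm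
    have h₃ := Nat.le_of_dvd (by omega) h₂
    omega
  · intro y _ hy
    refine if_neg fun h => hy ?_
    have h₁ := zmod_val_add_one (y - x)
    rw [h, Nat.mod_self, ZMod.val_eq_zero] at h₁
    linear_combination h₁
  · simp

theorem periodicD_periodicS_add {n : ℕ} (hn : n ≠ 0) (x y : ZMod m) :
    periodicD R m (periodicS R x (periodicBasis R n y)) +
      periodicS R x (periodicD R m (periodicBasis R n y)) = periodicBasis R n y := by
  obtain ⟨n, rfl⟩ := Nat.exists_eq_succ_of_ne_zero hn
  by_cases h : Even n
  · have h' : ¬ Even (n + 1) := Nat.even_add_one.not.2 (not_not.2 h)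
    rw [periodicD_periodicS_of_odd R h', periodicD_succ_of_even R h, map_sub,
      periodicS_of_even R h, periodicS_of_even R h, show y + 1 - x = y - x + 1 by ring,
      zmod_val_add_one]
    have hlast : x + (((y - x).val : ℕ) : ZMod m) = y := by simp
    by_cases hv : (y - x).val + 1 = m
    -- For `y = x - 1` the path to `y + 1 = x` is empty rather than a full turn; the norm term makes
    -- up for the missing full sum.
    · rw [if_pos hv, hv, Nat.mod_self, Finset.sum_range_zero, zero_sub, ← sub_eq_add_neg,
        sub_eq_iff_eq_add, periodicNorm,
        ← sum_range_add_eq_sum_zmod (fun z => periodicBasis R (n + 1) z) x]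
      have hsucc := Finset.sum_range_succ (fun j : ℕ => periodicBasis R (n + 1) (x + (j : ZMod m)))
        (y - x).val
      rw [hlast] at hsucc
      refine Eq.trans ?_ (hsucc.trans (add_comm _ _))
      exact congrArg (fun k => ∑ j ∈ Finset.range k, periodicBasis R (n + 1) (x + (j : ZMod m)))
        hv.symm
    · have := ZMod.val_lt (y - x)
      rw [if_neg hv, Nat.mod_eq_of_lt (by omega), Finset.sum_range_succ, hlast]
      abel
  · rw [periodicD_periodicS_of_even R (Nat.even_add_one.2 h), periodicD_succ_of_odd R h,
      periodicS_periodicNorm_of_odd R h, sub_add_cancel]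

variable (m) in
/-- The contractions of the periodic complex. -/
def periodicContraction :
    PointedContraction (periodicComplex R m) (dist (directedCycle m)) where
  deg b := b.1
  len b := periodicLength m b.1
  base b := b.2
  pt x := (0, x)
  s := periodicS R
  filt_eq p k := rfl
  deg_pt x := rfl
  len_pt x := by simp [periodicLength]
  base_pt x := rfl
  pt_base b hb := Prod.ext hb.symm rfl
  d_mem := periodicD_mem_supported R
  s_mem x b := by
    obtain ⟨n, y⟩ := b
    dsimp only
    by_cases hn : Even n
    · have h := periodicLength_succ_of_even m hn
      rw [periodicS_of_even R hn]
      refine Submodule.sum_mem _ fun j hj => Finsupp.single_mem_supported R _ ⟨rfl, ?_⟩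
      have hj' := Finset.mem_range.1 hj
      dsimp only
      rw [dist_directedCycle, dist_directedCycle, h, add_sub_cancel_left, ZMod.val_natCast]
      have := Nat.mod_le j m
      omega
    · have h := periodicLength_succ_of_odd m hn
      rw [periodicS_of_odd R hn]
      split_ifs with hv
      · refine Finsupp.single_mem_supported R _ ⟨rfl, ?_⟩
        dsimp only
        -- The distance `m - 1` lost by moving the base to `x` pays exactly for the gain in length.
        rw [dist_self, dist_directedCycle]
        omega
      · exact zero_mem _
  aug_d b hb := by
    obtain ⟨n, y⟩ := b
    obtain rfl : n = 1 := hb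
    change Finsupp.linearCombination R (fun _ => (1 : R)) (periodicD R m (periodicBasis R 1 y)) = 0
    rw [periodicD_succ_of_even R Even.zero]
    simp
  d_s_zero x b hb := by
    obtain ⟨n, y⟩ := b
    obtain rfl : n = 0 := hb
    exact periodicD_periodicS_of_even R Even.zero x y
  d_s x b hb := periodicD_periodicS_add R hb x b.2

variable (m) in
/-- The pages of the magnitude-path spectral sequence of the directed cycle, from the first on, are
those of the periodic complex. -/
theorem reachability_page_equiv {r : ℕ} (hr : 1 ≤ r) (p k : ℤ) :
    Nonempty ((reachability R (directedCycle m)).Page r p k ≃ₗ[R] (periodicComplex R m).Page r p k) :=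
  (reachabilityContraction R reach_directedCycle).page_equiv (periodicContraction R m)
    (dist_self _) (fun x y z => dist_triangle (reach_directedCycle x y) (reach_directedCycle y z))
    hr p k

end Periodic

theorem FilteredComplex.page_subsingleton_of_filt_le {R : Type v} [CommRing R] {M : Type u}
    [AddCommGroup M] [Module R M] (C : FilteredComplex R M) (r : ℕ) {p k : ℤ}
    (h : C.filt p k ≤ C.filt (p - 1) k) : Subsingleton (C.Page r p k) :=
  subquotient_subsingleton (sup_le (fun _ hc => Submodule.mem_sup_right (h hc.1)) le_sup_right)

/-! ### Lengths in the periodic complex. -/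

section PeriodicLength

theorem periodicLength_add_one_le {m : ℕ} (hm : 3 ≤ m) (n : ℕ) :
    periodicLength m n + 1 ≤ periodicLength m (n + 1) := by
  by_cases hn : Even n
  · have := periodicLength_succ_of_even m hn
    omega
  · have := periodicLength_succ_of_odd m hn
    omega

theorem periodicLength_two_mul (m i : ℕ) : (periodicLength m (2 * i) : ℤ) = m * i := by
  rw [periodicLength, Nat.mul_div_cancel_left _ two_pos, Nat.mul_mod_right]
  push_cast
  ring

theorem periodicLength_two_mul_add_one (m i : ℕ) :
    (periodicLength m (2 * i + 1) : ℤ) = m * i + 1 := by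
  rw [periodicLength_succ_of_even m (even_two_mul i), Nat.cast_succ, periodicLength_two_mul]

theorem ne_periodicLength {m : ℕ} {k ℓ : ℤ}
    (h : ∀ i : ℕ, ¬ (k = 2 * i ∧ ℓ = m * i) ∧ ¬ (k = 2 * i + 1 ∧ ℓ = m * i + 1)) (n : ℕ) :
    ¬ (k = n ∧ ℓ = periodicLength m n) := by
  rintro ⟨rfl, rfl⟩
  obtain ⟨i, rfl | rfl⟩ := Nat.even_or_odd' n
  · exact (h i).1 ⟨by push_cast; ring, periodicLength_two_mul m i⟩
  · exact (h i).2 ⟨by push_cast; ring, periodicLength_two_mul_add_one m i⟩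

end PeriodicLength

/-! ### Pages of the periodic complex. -/

section PeriodicPages

variable (R : Type v) [CommRing R] {m : ℕ}

variable (m) in
/-- The sum of the coefficients of a chain. -/
def periodicAug : (ℕ × ZMod m →₀ R) →ₗ[R] R := Finsupp.linearCombination R fun _ => (1 : R)

@[simp]
theorem periodicAug_periodicBasis (n : ℕ) (x : ZMod m) :
    periodicAug R m (periodicBasis R n x) = 1 := by
  simp [periodicAug]

variable [NeZero m]

variable (m) in
/-- The part of degree `n` of the periodic complex. -/
def periodicPart (n : ℕ) : Submodule R (ℕ × ZMod m →₀ R) :=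
  Finsupp.supported R R {b | b.1 = n}

variable {R}

theorem periodicComplex_filt_of_le {n : ℕ} {p : ℤ} (h : (periodicLength m n : ℤ) ≤ p) :
    (periodicComplex R m).filt p n = periodicPart R m n := by
  refine congrArg (Finsupp.supported R R) (Set.ext fun b => ⟨fun hb => Int.ofNat_inj.1 hb.1, ?_⟩)
  rintro rfl
  exact ⟨rfl, h⟩

theorem periodicComplex_filt_eq_bot {k p : ℤ}
    (h : ∀ n : ℕ, (n : ℤ) = k → p < periodicLength m n) :
    (periodicComplex R m).filt p k = ⊥ := by
  refine eq_bot_iff.2 fun c hc => (Submodule.mem_bot R).2 ?_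
  ext b
  exact (Finsupp.mem_supported' R _).1 hc b fun hb => absurd hb.2 (not_le.2 (h _ hb.1))

theorem periodicComplex_filt_of_lt {n : ℕ} {p : ℤ} (h : p < periodicLength m n) :
    (periodicComplex R m).filt p n = ⊥ :=
  periodicComplex_filt_eq_bot fun n' hn' => by rwa [Int.ofNat_inj.1 hn']

theorem periodicComplex_page_subsingleton (r : ℕ) {p k : ℤ}
    (h : ∀ n : ℕ, ¬ (k = n ∧ p = periodicLength m n)) :
    Subsingleton ((periodicComplex R m).Page r p k) := by
  refine (periodicComplex R m).page_subsingleton_of_filt_le r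
    (Finsupp.supported_mono fun b hb => ⟨hb.1, ?_⟩)
  have h₁ := h b.1
  obtain ⟨h₂, h₃⟩ := hb
  omega

/-- Each degree carries a single length, so the lower filtration step is zero and the page is
determined by actual chains. The lemmas below turn this into a comparison of `r` with the jump in
length between consecutive degrees: a differential matters on page `r` exactly when its jump is less
than `r`. -/
theorem mem_periodicComplex_pageZ {r n : ℕ} {c : ℕ × ZMod m →₀ R} :
    c ∈ (periodicComplex R m).pageZ r (periodicLength m n) n ↔
      c ∈ periodicPart R m n ∧
        periodicD R m c ∈ (periodicComplex R m).filt (periodicLength m n - r) (n - 1) := by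
  rw [FilteredComplex.pageZ, periodicComplex_filt_of_lt (by omega), sup_bot_eq,
    FilteredComplex.mem_approxCycles, periodicComplex_filt_of_le le_rfl]
  rfl

theorem mem_periodicComplex_pageB {r n : ℕ} {c : ℕ × ZMod m →₀ R} :
    c ∈ (periodicComplex R m).pageB r (periodicLength m n) n ↔
      ∃ b ∈ (periodicComplex R m).filt (periodicLength m n + r - 1) (n + 1 : ℕ),
        periodicD R m b = c := by
  rw [FilteredComplex.pageB, periodicComplex_filt_of_lt (by omega), sup_bot_eq]
  refine ⟨fun ⟨b, hb, h⟩ => ⟨b, hb.1, h⟩, fun ⟨b, hb, h⟩ => ⟨b, ⟨hb, ?_⟩, h⟩⟩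
  have h₁ := (periodicComplex R m).d_mem _ _ _ hb
  rw [Nat.cast_succ, add_sub_cancel_right] at h₁
  rw [SetLike.mem_coe, Submodule.mem_comap, add_sub_cancel_right, periodicComplex_filt_of_le (by omega)]
  exact Finsupp.supported_mono (fun b hb => Int.ofNat_inj.1 hb.1) h₁

theorem mem_pageB_iff_eq_zero {r n : ℕ}
    (h : periodicLength m n + r ≤ periodicLength m (n + 1)) {c : ℕ × ZMod m →₀ R} :
    c ∈ (periodicComplex R m).pageB r (periodicLength m n) n ↔ c = 0 := by
  rw [mem_periodicComplex_pageB, periodicComplex_filt_of_lt (by omega)]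
  simp [eq_comm]

theorem mem_pageB_iff_exists {r n : ℕ}
    (h : periodicLength m (n + 1) < periodicLength m n + r) {c : ℕ × ZMod m →₀ R} :
    c ∈ (periodicComplex R m).pageB r (periodicLength m n) n ↔
      ∃ b ∈ periodicPart R m (n + 1), periodicD R m b = c := by
  rw [mem_periodicComplex_pageB, periodicComplex_filt_of_le (by omega)]

theorem mem_pageZ_zero_iff {r : ℕ} {c : ℕ × ZMod m →₀ R} :
    c ∈ (periodicComplex R m).pageZ r (periodicLength m 0) (0 : ℕ) ↔ c ∈ periodicPart R m 0 := by
  rw [mem_periodicComplex_pageZ, and_iff_left_iff_imp]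
  intro hc
  rw [linearMap_congr_supported (g := 0) (fun b hb => ?_) hc]
  · exact zero_mem _
  · rw [periodicD_single, LinearMap.zero_apply, ← Prod.mk.eta (p := b), show b.1 = 0 from hb]
    rfl

theorem periodicD_mem_periodicPart {n : ℕ} {c : ℕ × ZMod m →₀ R}
    (hc : c ∈ periodicPart R m (n + 1)) : periodicD R m c ∈ periodicPart R m n :=
  linearMap_mem_of_supported (fun b hb => Finsupp.supported_mono (fun b' hb' => by
    have h₁ := hb'.1
    have h₂ : b.1 = n + 1 := hb
    change b'.1 = n
    omega) (periodicD_mem_supported R b.2 b)) hc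

theorem mem_pageZ_succ_iff_of_le {r n : ℕ}
    (h : periodicLength m n + r ≤ periodicLength m (n + 1)) {c : ℕ × ZMod m →₀ R} :
    c ∈ (periodicComplex R m).pageZ r (periodicLength m (n + 1)) (n + 1 : ℕ) ↔
      c ∈ periodicPart R m (n + 1) := by
  rw [mem_periodicComplex_pageZ, Nat.cast_succ, add_sub_cancel_right,
    periodicComplex_filt_of_le (by omega), and_iff_left_iff_imp]
  exact periodicD_mem_periodicPart

theorem mem_pageZ_succ_iff_of_lt {r n : ℕ}
    (h : periodicLength m (n + 1) < periodicLength m n + r) {c : ℕ × ZMod m →₀ R} :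
    c ∈ (periodicComplex R m).pageZ r (periodicLength m (n + 1)) (n + 1 : ℕ) ↔
      c ∈ periodicPart R m (n + 1) ∧ periodicD R m c = 0 := by
  rw [mem_periodicComplex_pageZ, Nat.cast_succ, add_sub_cancel_right,
    periodicComplex_filt_of_lt (by omega), Submodule.mem_bot]

theorem periodicS_mem_periodicPart {n : ℕ} (x : ZMod m) {c : ℕ × ZMod m →₀ R}
    (hc : c ∈ periodicPart R m n) : periodicS R x c ∈ periodicPart R m (n + 1) :=
  linearMap_mem_of_supported (fun b hb => Finsupp.supported_mono (fun b' hb' => by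
    have h₁ : b'.1 = b.1 + 1 := hb'.1
    have h₂ : b.1 = n := hb
    change b'.1 = n + 1
    omega) ((periodicContraction R m).s_mem x b)) hc

/-- Contracting to the vertex `0` exhibits `c` minus its coefficient sum times one basis element as
a boundary. -/
theorem exists_periodicD_eq_iff_of_even {n : ℕ} (hn : Even n) {c : ℕ × ZMod m →₀ R}
    (hc : c ∈ periodicPart R m n) :
    (∃ b ∈ periodicPart R m (n + 1), periodicD R m b = c) ↔ periodicAug R m c = 0 := by
  constructor
  · rintro ⟨b, hb, rfl⟩
    refine linearMap_congr_supported (f := periodicAug R m ∘ₗ periodicD R m) (g := 0) ?_ hb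
    rintro ⟨_, x⟩ rfl
    rw [LinearMap.comp_apply, periodicD_succ_of_even R hn, map_sub]
    simp
  · intro h
    refine ⟨periodicS R 0 c, periodicS_mem_periodicPart 0 hc, ?_⟩
    have h₁ := linearMap_congr_supported (f := periodicD R m ∘ₗ periodicS R 0)
      (g := LinearMap.id - (periodicAug R m).smulRight (periodicBasis R n 0)) ?_ hc
    · simpa [h] using h₁
    · rintro ⟨_, x⟩ rfl
      rw [LinearMap.comp_apply, periodicD_periodicS_of_even R hn]
      simp

theorem periodicD_succ_eq_of_odd {n : ℕ} (hn : ¬ Even n) {c : ℕ × ZMod m →₀ R}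
    (hc : c ∈ periodicPart R m (n + 1)) :
    periodicD R m c = periodicAug R m c • periodicNorm R n := by
  refine linearMap_congr_supported (g := (periodicAug R m).smulRight (periodicNorm R n)) ?_ hc
  rintro ⟨_, x⟩ rfl
  rw [periodicD_succ_of_odd R hn]
  simp

theorem periodicNorm_apply (n : ℕ) (x : ZMod m) : periodicNorm R n (n, x) = 1 := by
  classical
  simp [periodicNorm, Finsupp.finsetSum_apply, Finsupp.single_apply]

theorem periodicD_periodicS_eq_self {n : ℕ} {c : ℕ × ZMod m →₀ R}
    (hc : c ∈ periodicPart R m (n + 1)) (h : periodicD R m c = 0) (x : ZMod m) :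
    periodicD R m (periodicS R x c) = c := by
  have h₁ := linearMap_congr_supported
    (f := periodicD R m ∘ₗ periodicS R x + periodicS R x ∘ₗ periodicD R m) (g := LinearMap.id)
    (by rintro ⟨_, y⟩ rfl; exact periodicD_periodicS_add R n.succ_ne_zero x y) hc
  simpa [h] using h₁

/-- The cycles of odd degree are the multiples of the norm element. -/
theorem eq_smul_periodicNorm {n : ℕ} (hn : Even n) {c : ℕ × ZMod m →₀ R}
    (hc : c ∈ periodicPart R m (n + 1)) (h : periodicD R m c = 0) :
    c = c (n + 1, 0) • periodicNorm R (n + 1) := by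
  have hn' : ¬ Even (n + 1) := Nat.even_add_one.not.2 (not_not.2 hn)
  have h₁ : c = periodicAug R m (periodicS R 0 c) • periodicNorm R (n + 1) := by
    rw [← periodicD_succ_eq_of_odd hn' (periodicS_mem_periodicPart 0 hc),
      periodicD_periodicS_eq_self hc h]
  have h₂ : c (n + 1, 0) = periodicAug R m (periodicS R 0 c) := by
    conv_lhs => rw [h₁]
    rw [Finsupp.smul_apply, periodicNorm_apply, smul_eq_mul, mul_one]
  rw [h₂]
  exact h₁

theorem periodicComplex_page_one_equiv (hm : 3 ≤ m) (n : ℕ) :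
    Nonempty ((periodicComplex R m).Page 1 (periodicLength m n) n ≃ₗ[R] (Fin m → R)) := by
  have hZ : ∀ c, c ∈ (periodicComplex R m).pageZ 1 (periodicLength m n) n ↔
      c ∈ periodicPart R m n := by
    intro c
    cases n with
    | zero => exact mem_pageZ_zero_iff
    | succ n => exact mem_pageZ_succ_iff_of_le (periodicLength_add_one_le hm _)
  have e := (ZMod.finEquiv m).toEquiv
  refine subquotient_equiv_of_surjective (LinearMap.pi fun j => Finsupp.lapply (n, e j))
    (fun v => ?_) fun c hc => ?_
  · refine ⟨∑ y, v (e.symm y) • periodicBasis R n y, (hZ _).2 (Submodule.sum_mem _ fun y _ =>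
      Submodule.smul_mem _ _ (Finsupp.single_mem_supported R _ rfl)), ?_⟩
    classical
    ext j
    simp [Finsupp.single_apply]
  · rw [mem_pageB_iff_eq_zero (periodicLength_add_one_le hm _)]
    refine ⟨fun h => ?_, fun h => by rw [h, map_zero]⟩
    ext ⟨n', x⟩
    by_cases hn : n' = n
    · subst hn
      simpa using congrFun h (e.symm x)
    · exact (Finsupp.mem_supported' R _).1 ((hZ c).1 hc) _ hn

/-- The incoming jump `1` is below `r`, so differences are divided out, while the outgoing jump `m -
1` is not, so there is no cycle condition. Degree zero has no outgoing differential, hence needs no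
upper bound on `r`. -/
theorem periodicComplex_page_equiv_of_even {r n : ℕ} (hn : Even n) (hr : 2 ≤ r)
    (h : n = 0 ∨ r + 1 ≤ m) :
    Nonempty ((periodicComplex R m).Page r (periodicLength m n) n ≃ₗ[R] R) := by
  have hZ : ∀ c, c ∈ (periodicComplex R m).pageZ r (periodicLength m n) n ↔
      c ∈ periodicPart R m n := by
    intro c
    cases n with
    | zero => exact mem_pageZ_zero_iff
    | succ n =>
      have := periodicLength_succ_of_odd m (Nat.even_add_one.1 hn)
      exact mem_pageZ_succ_iff_of_le (by omega)
  have hL := periodicLength_succ_of_even m hn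
  refine subquotient_equiv_of_surjective (periodicAug R m) (fun a =>
    ⟨a • periodicBasis R n 0, (hZ _).2 (Submodule.smul_mem _ _
      (Finsupp.single_mem_supported R _ rfl)), by rw [map_smul]; simp⟩) fun c hc => ?_
  rw [mem_pageB_iff_exists (by omega), exists_periodicD_eq_iff_of_even hn ((hZ c).1 hc)]

/-- Now the outgoing jump is `1` and the incoming one `m - 1`: the page is the module of cycles,
spanned by the norm. -/
theorem periodicComplex_page_equiv_of_odd {r n : ℕ} (hn : Even n) (hr : 2 ≤ r)
    (h : r + 1 ≤ m) :
    Nonempty ((periodicComplex R m).Page r (periodicLength m (n + 1)) (n + 1 : ℕ) ≃ₗ[R] R) := by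
  have hL := periodicLength_succ_of_even m hn
  have hL' := periodicLength_succ_of_odd m (Nat.even_add_one.not.2 (not_not.2 hn))
  refine subquotient_equiv_of_surjective (Finsupp.lapply (n + 1, 0)) (fun a =>
    ⟨a • periodicNorm R (n + 1), ?_, ?_⟩) fun c hc => ?_
  · rw [mem_pageZ_succ_iff_of_lt (by omega), map_smul, periodicD_periodicNorm R hn, smul_zero]
    exact ⟨Submodule.smul_mem _ _ (periodicNorm_mem_supported R fun _ => rfl), rfl⟩
  · rw [map_smul, Finsupp.lapply_apply, periodicNorm_apply, smul_eq_mul, mul_one]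
  · rw [mem_pageB_iff_eq_zero (by omega), Finsupp.lapply_apply]
    rw [mem_pageZ_succ_iff_of_lt (by omega)] at hc
    refine ⟨fun h => ?_, fun h => by rw [h, Finsupp.zero_apply]⟩
    rw [eq_smul_periodicNorm hn hc.1 hc.2, h, zero_smul]

/-- Both jumps `1` and `m - 1` are below `m`, so this page is the homology of the periodic complex,
which is acyclic in positive degrees. -/
theorem periodicComplex_page_subsingleton_succ (hm : 3 ≤ m) (n : ℕ) :
    Subsingleton ((periodicComplex R m).Page m (periodicLength m (n + 1)) (n + 1 : ℕ)) := by
  refine subquotient_subsingleton fun c hc => ?_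
  by_cases hn : Even n
  · have hL := periodicLength_succ_of_even m hn
    have hL' := periodicLength_succ_of_odd m (Nat.even_add_one.not.2 (not_not.2 hn))
    rw [mem_pageZ_succ_iff_of_lt (by omega)] at hc
    rw [mem_pageB_iff_exists (by omega)]
    exact ⟨_, periodicS_mem_periodicPart 0 hc.1, periodicD_periodicS_eq_self hc.1 hc.2 0⟩
  · have hL := periodicLength_succ_of_odd m hn
    have hL' := periodicLength_succ_of_even m (Nat.even_add_one.2 hn)
    rw [mem_pageZ_succ_iff_of_lt (by omega)] at hc
    have hd := hc.2
    rw [periodicD_succ_eq_of_odd hn hc.1] at hd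
    rw [mem_pageB_iff_exists (by omega), exists_periodicD_eq_iff_of_even (Nat.even_add_one.2 hn) hc.1]
    have h := DFunLike.congr_fun hd (n, (0 : ZMod m))
    rwa [Finsupp.smul_apply, periodicNorm_apply, smul_eq_mul, mul_one] at h

end PeriodicPages

/-! ### Transfer to the directed cycle and vanishing of differentials. -/

section CyclePages

variable {R : Type v} [CommRing R] {m : ℕ} [NeZero m]

theorem reachability_page_subsingleton {r : ℕ} (hr : 1 ≤ r) {p k : ℤ}
    (h : ∀ n : ℕ, ¬ (k = n ∧ p = periodicLength m n)) :
    Subsingleton ((reachability R (directedCycle m)).Page r p k) := by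
  obtain ⟨e⟩ := reachability_page_equiv R m hr p k
  have := periodicComplex_page_subsingleton (R := R) r h
  exact e.toEquiv.subsingleton

/-- Between the second and the `(m - 1)`-st page there is no room for a nonzero differential. -/
theorem reachability_pageDiff_eq_zero {r : ℕ} (hr : 2 ≤ r) (hrm : r + 2 ≤ m) (p k : ℤ) :
    (reachability R (directedCycle m)).pageDiff r p k = 0 := by
  by_cases h : ∀ n : ℕ, ¬ (k = n ∧ p = periodicLength m n)
  · have := reachability_page_subsingleton (R := R) (r := r) (by omega) h
    exact Subsingleton.elim _ _
  · push Not at h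
    obtain ⟨n, rfl, rfl⟩ := h
    -- Lowering a nonzero bidegree by one degree must lower the length by `1` or `m - 1`, and `2 ≤ r
    -- ≤ m - 2` excludes both; the target is zero.
    have := reachability_page_subsingleton (R := R) (m := m) (r := r) (by omega)
      (p := periodicLength m n - r) (k := n - 1) fun n' ⟨h₁, h₂⟩ => by
        obtain rfl : n = n' + 1 := by omega
        by_cases hn : Even n'
        · have := periodicLength_succ_of_even m hn
          omega
        · have := periodicLength_succ_of_odd m hn
          omega
    exact LinearMap.ext fun _ => Subsingleton.elim _ _

end CyclePages

end MagnitudePath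

end

/-! ### The theorem on directed cycles. -/

open MagnitudePath in
theorem mainTheorem4 {R : Type*} [CommRing R] (m : ℕ) (hm : 3 ≤ m) :
    -- magnitude homology
    (∀ i : ℕ,
      Nonempty (MH R (directedCycle m) (2 * i) (m * i) ≃ₗ[R] (Fin m → R)) ∧
      Nonempty (MH R (directedCycle m) (2 * i + 1) (m * i + 1) ≃ₗ[R] (Fin m → R))) ∧
    (∀ k ℓ : ℤ,
      (∀ i : ℕ, ¬ (k = 2 * i ∧ ℓ = m * i) ∧ ¬ (k = 2 * i + 1 ∧ ℓ = m * i + 1)) →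
      Subsingleton (MH R (directedCycle m) k ℓ)) ∧
    -- bigraded path homology
    (∀ i : ℕ,
      Nonempty (PH R (directedCycle m) (2 * i) (m * i) ≃ₗ[R] R) ∧
      Nonempty (PH R (directedCycle m) (2 * i + 1) (m * i + 1) ≃ₗ[R] R)) ∧
    (∀ k ℓ : ℤ,
      (∀ i : ℕ, ¬ (k = 2 * i ∧ ℓ = m * i) ∧ ¬ (k = 2 * i + 1 ∧ ℓ = m * i + 1)) →
      Subsingleton (PH R (directedCycle m) k ℓ)) ∧
    -- the pages from the second to the `(m - 1)`-st agree, all differentials between them vanishing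
    (∀ r : ℕ, 2 ≤ r → r + 1 ≤ m - 1 →
      (reachability R (directedCycle m)).PagesEqual r (r + 1) ∧
      ∀ p k : ℤ, (reachability R (directedCycle m)).pageDiff r p k = 0) ∧
    -- the `m`-th page is a single copy of `R` in bidegree `(0, 0)`
    Nonempty (E R (directedCycle m) m 0 0 ≃ₗ[R] R) ∧
    (∀ i j : ℤ, (i, j) ≠ (0, 0) → Subsingleton (E R (directedCycle m) m i j)) := by
  have : NeZero m := ⟨by omega⟩
  have hMH : ∀ (n : ℕ) (k ℓ : ℤ), k = n → ℓ = periodicLength m n →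
      Nonempty (MH R (directedCycle m) k ℓ ≃ₗ[R] (Fin m → R)) := by
    rintro n _ _ rfl rfl
    obtain ⟨e₁⟩ := MH_equiv_page_one R (directedCycle m) n (periodicLength m n)
    obtain ⟨e₂⟩ := reachability_page_equiv R m le_rfl (periodicLength m n) n
    obtain ⟨e₃⟩ := periodicComplex_page_one_equiv (R := R) hm n
    exact ⟨(e₁.trans e₂).trans e₃⟩
  have hPH : ∀ (n : ℕ) (k ℓ : ℤ), k = n → ℓ = periodicLength m n →
      Nonempty ((reachability R (directedCycle m)).Page 2 ℓ k ≃ₗ[R] R) := by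
    rintro n _ _ rfl rfl
    obtain ⟨e₁⟩ := reachability_page_equiv R m one_le_two (periodicLength m n) n
    obtain ⟨i, rfl | rfl⟩ := Nat.even_or_odd' n
    · obtain ⟨e₂⟩ := periodicComplex_page_equiv_of_even (R := R) (m := m) (even_two_mul i) le_rfl
        (Or.inr hm)
      exact ⟨e₁.trans e₂⟩
    · obtain ⟨e₂⟩ := periodicComplex_page_equiv_of_odd (R := R) (m := m) (even_two_mul i) le_rfl hm
      exact ⟨e₁.trans e₂⟩
  refine ⟨fun i => ⟨?_, ?_⟩, fun k ℓ h => ?_, fun i => ⟨?_, ?_⟩, fun k ℓ h => ?_,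
    fun r hr hrm => ?_, ?_, fun i j hij => ?_⟩
  · exact hMH (2 * i) _ _ (by push_cast; ring) (periodicLength_two_mul m i).symm
  · exact hMH (2 * i + 1) _ _ (by push_cast; ring) (periodicLength_two_mul_add_one m i).symm
  · obtain ⟨e⟩ := MH_equiv_page_one R (directedCycle m) k ℓ
    have := reachability_page_subsingleton (R := R) le_rfl (ne_periodicLength h)
    exact e.toEquiv.subsingleton
  · exact hPH (2 * i) _ _ (by push_cast; ring) (periodicLength_two_mul m i).symm
  · exact hPH (2 * i + 1) _ _ (by push_cast; ring) (periodicLength_two_mul_add_one m i).symm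
  · rw [PH, E, add_sub_cancel]
    exact reachability_page_subsingleton one_le_two (ne_periodicLength h)
  · have h := reachability_pageDiff_eq_zero (R := R) (m := m) hr (by omega)
    exact ⟨FilteredComplex.pagesEqual_of_pageDiff_eq_zero h, h⟩
  · obtain ⟨e₁⟩ := reachability_page_equiv R m (r := m) (by omega) 0 0
    obtain ⟨e₂⟩ := periodicComplex_page_equiv_of_even (R := R) (m := m) (r := m) Even.zero
      (by omega) (Or.inl rfl)
    rw [show periodicLength m 0 = 0 from rfl] at e₂
    exact ⟨e₁.trans e₂⟩
  -- Off the bidegrees of the periodic complex every page vanishes; on them, `n = 0` is the excluded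
  -- bidegree and positive `n` is acyclicity.
  · by_cases h : ∀ n : ℕ, ¬ (i + j = n ∧ i = periodicLength m n)
    · exact reachability_page_subsingleton (by omega) h
    · push Not at h
      obtain ⟨n, h₁, h₂⟩ := h
      obtain ⟨e⟩ := reachability_page_equiv R m (r := m) (by omega) i (i + j)
      cases n with
      | zero =>
        have h₃ : periodicLength m 0 = 0 := rfl
        rw [h₃] at h₂
        refine absurd (Prod.ext h₂ ?_) hij
        change j = 0
        simp only [Nat.cast_zero] at h₁ h₂
        omega
      | succ n =>
        have := periodicComplex_page_subsingleton_succ (R := R) hm n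
        rw [← h₁, ← h₂] at this
        exact e.toEquiv.subsingleton
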